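/- Let $q>7$ be a prime power with $q\equiv 7\pmod{10}$, and put $n=\frac{q^2+1}{10}$, $r=q+1$, $s=\frac{q^2+1}{2}$. Let $\alpha\in\mathbb F_{q^2}$ be a primitive $r$-th root of unity, and let $\delta$, in an extension field of $\mathbb F_{q^2}$, be a primitive $rn$-th root of unity with $\delta^n=\alpha$. For an integer $i$ let $C_i=\{iq^{2j} \bmod rn : j\in\mathbb Z\}$ be its $q^2$-cyclotomic coset modulo $rn$. An $\alpha$-constacyclic code $\mathcal C\subseteq\mathbb F_{q^2}^n$ is an ideal of $\mathbb F_{q^2}[x]/(x^n-\alpha)$, generated by a monic divisor $g$ of $x^n-\alpha$; its defining set is the set of all $i\in\{1+rj: 0\le j\le n-1\}$, taken modulo $rn$, with $g(\delta^i)=0$. Let $\lambda$ be an integer with $1\le\lambda\le\frac{q+3}{10}$, and let $\mathcal C$ be the $\alpha$-constacyclic code of length $n$ over $\mathbb F_{q^2}$ with defining set $$Z=\bigcup_{j=0}^{\frac{3(q-7)}{10}+1+\lambda} C_{s-rj}.$$ Put $k=n-\frac65(q-7)-4\lambda-1$ and $d=\frac35(q-7)+2\lambda+4$. Then: 1. $Z\cap(-qZ)=C_s\cup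 C_{s-r\frac{3q-1}{10}}\cup C_{s-r\frac{q+3}{10}}$, and this set has exactly $5$ elements (here $-qZ=\{-qz \bmod rn: z\in Z\}$). 2. $\mathcal C$ is an MDS code of dimension $n-d+1$ and minimum distance $d$, and $\operatorname{rank}(HH^*)=5$ for every $(d-1)\times n$ parity check matrix $H$ of $\mathcal C$, where $H^*$ is the conjugate transpose of $H$ with respect to $x\mapsto x^q$. 3. There exists an EAQMDS code with parameters $[[n,k,d;5]]_q$, that is, $$\Bigl[\Bigl[n,\ n-\tfrac65(q-7)-4\lambda-1,\ \tfrac35(q-7)+2\lambda+4;\ 5\Bigr]\Bigr]_q .$$ Here an entanglement-assisted quantum code $[[n,k,d;c]]_q$ encodes $k$ qudits of dimension $q$ into $n$ qudits: the sender applies an isometry $V:(\mathbb C^q)^{\otimes k}\otimes(\mathbb C^q)^{\otimes c}\to(\mathbb C^q)^{\otimes n}$ to the information qudits and her halves of $c$ maximally entangled pairs of qudits shared with the receiver, whose halves are free of errors. Its minimum distance is $d$ if $P(E\otimes 1)P$ is a scalar multiple of $P$ (the orthogonal projection onto the code space in $(\mathbb C^q)^{\otimes n}\otimes(\mathbb C^q)^{\otimes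 c}$) for every operator $E$ that acts on fewer than $d$ of the $n$ qudits, but not for every $E$ that acts on $d$ of them. It is an EAQMDS code if $d\le\frac{n+2}{2}$ and $n+c-k=2(d-1)$. -/

import Mathlib

open scoped Matrix Kronecker

/-! ### Constacyclic codes -/

/-- The constacyclic shift `(c₀, …, c_{n-1}) ↦ (α c_{n-1}, c₀, …, c_{n-2})`. -/
def constacyclicShift {F : Type*} [Field F] {n : ℕ} (α : F) (c : Fin n → F) : Fin n → F :=
  fun i =>
    if i.val = 0 then α * c ⟨n - 1, by have := i.isLt; omega⟩
    else c ⟨i.val - 1, by have := i.isLt; omega⟩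

/-- A linear code is `α`-constacyclic if it is closed under the `α`-constacyclic shift. -/
def IsConstacyclic {F : Type*} [Field F] {n : ℕ} (α : F) (C : Submodule F (Fin n → F)) : Prop :=
  ∀ c ∈ C, constacyclicShift α c ∈ C

/-- The polynomial `c₀ + c₁ x + ⋯ + c_{n-1} x^{n-1}` of a word. -/
noncomputable def wordPoly {F : Type*} [Field F] {n : ℕ} (c : Fin n → F) : Polynomial F :=
  ∑ i, Polynomial.monomial i.val (c i)

/-- `g` is the monic divisor of `x ^ n - α` that generates `C`, as an ideal of
`F[x] / (x ^ n - α)`: the codewords are the words whose polynomial is a multiple of `g`. -/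
def IsGeneratorPoly {F : Type*} [Field F] {n : ℕ} (α : F) (C : Submodule F (Fin n → F))
    (g : Polynomial F) : Prop :=
  g.Monic ∧ g ∣ Polynomial.X ^ n - Polynomial.C α ∧ ∀ c : Fin n → F, c ∈ C ↔ g ∣ wordPoly c

/-- The exponents `{1 + r j | 0 ≤ j ≤ n - 1}` modulo `r n`. -/
def exponentSet (r n : ℕ) : Set (ZMod (r * n)) :=
  {i | ∃ j : ℕ, j < n ∧ i = 1 + (r : ZMod (r * n)) * j}

/-- `Z` is the defining set of the `α`-constacyclic code `C` with respect to the `r n`-th root of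
unity `δ` (which lives in an extension field `K` of `F`): the set of exponents `i ≡ 1 (mod r)`,
taken modulo `r n`, for which `δ ^ i` is a root of the generator polynomial of `C`. -/
def HasDefiningSet {F K : Type*} [Field F] [Field K] [Algebra F K] {n : ℕ} (r : ℕ) (α : F) (δ : K)
    (C : Submodule F (Fin n → F)) (Z : Set (ZMod (r * n))) : Prop :=
  ∃ g : Polynomial F, IsGeneratorPoly α C g ∧
    Z = {i | i ∈ exponentSet r n ∧ Polynomial.aeval (δ ^ i.val) g = 0}

/-- The `q²`-cyclotomic coset of `i` modulo `m`. (For `q` prime to `m`, multiplication by `q²` has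
finite order, so nonnegative exponents give the same set as all integer exponents.) -/
def cyclotomicCoset (q m : ℕ) (i : ZMod m) : Set (ZMod m) :=
  {x | ∃ j : ℕ, x = i * (q : ZMod m) ^ (2 * j)}

/-- The set `-q Z` modulo `m`. -/
def negMulSet (q : ℕ) {m : ℕ} (Z : Set (ZMod m)) : Set (ZMod m) :=
  (fun z => -((q : ZMod m) * z)) '' Z

/-- `d` is the minimum weight of the nonzero codewords of `C`. -/
def IsMinWeight {F : Type*} [Field F] [DecidableEq F] {n : ℕ} (C : Submodule F (Fin n → F))
    (d : ℕ) : Prop :=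
  IsLeast {w | ∃ c ∈ C, c ≠ 0 ∧ hammingNorm c = w} d

/-- `H` is a parity check matrix of the code `C`: it has `n - dim C` rows and kernel `C`. -/
def IsParityCheck {F : Type*} [Field F] {m n : ℕ} (C : Submodule F (Fin n → F))
    (H : Matrix (Fin m) (Fin n) F) : Prop :=
  Module.finrank F C + m = n ∧ ∀ v : Fin n → F, v ∈ C ↔ H *ᵥ v = 0

/-- The conjugate transpose of a matrix over the field with `q²` elements, where conjugation is
`x ↦ x ^ q`. -/
def hermTranspose {F : Type*} [Field F] {m n : ℕ} (q : ℕ) (H : Matrix (Fin m) (Fin n) F) :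
    Matrix (Fin n) (Fin m) F :=
  (H.map (fun x => x ^ q))ᵀ

/-! ### Entanglement-assisted quantum codes

`m` qudits with computational basis labelled by the alphabet `A` have the state space
`(Fin m → A) → ℂ`, with the inner product `star φ ⬝ᵥ ψ`. -/

/-- An entanglement-assisted quantum code that encodes `k` qudits into `n` qudits with the help of
`c` maximally entangled pairs of qudits shared by sender and receiver. The sender applies an
isometry to the `k` information qudits and to her halves of the `c` pairs (equivalently: a unitary
operator on these `k + c` qudits and `n - k - c` ancillas in a fixed state), and transmits the
resulting `n` qudits. -/
structure EAQECC (A : Type*) [Fintype A] [DecidableEq A] (n k c : ℕ) where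
  /-- the matrix of the encoding isometry -/
  encoder : Matrix (Fin n → A) ((Fin k → A) × (Fin c → A)) ℂ
  isometry : encoderᴴ * encoder = 1

namespace EAQECC

variable {A : Type*} [Fintype A] [DecidableEq A] {n k c : ℕ}

/-- The encoding map. It sends `ψ` to the joint state of the `n` transmitted qudits and of the
receiver's halves of the `c` pairs, that is, to `(V ⊗ 1) (ψ ⊗ Φ)`, where `V` is the encoding
isometry and `Φ = |A| ^ (-c / 2) ∑_b |b⟩ |b⟩` is the state of the `c` pairs. -/
noncomputable def encode (Q : EAQECC A n k c) :
    ((Fin k → A) → ℂ) →ₗ[ℂ] ((Fin n → A) × (Fin c → A) → ℂ) where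
  toFun ψ := fun p =>
    ((Real.sqrt ((Fintype.card A : ℝ) ^ c) : ℝ) : ℂ)⁻¹ * ∑ u, Q.encoder p.1 (u, p.2) * ψ u
  map_add' ψ φ := by
    funext p
    simp only [Pi.add_apply, mul_add, Finset.sum_add_distrib]
  map_smul' a ψ := by
    funext p
    simp only [Pi.smul_apply, smul_eq_mul, RingHom.id_apply, Finset.mul_sum]
    refine Finset.sum_congr rfl fun u _ => ?_
    ring

/-- The code space, a subspace of the joint state space of the `n` transmitted qudits and the
receiver's `c` qudits. -/
noncomputable def codeSpace (Q : EAQECC A n k c) :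
    Submodule ℂ ((Fin n → A) × (Fin c → A) → ℂ) :=
  LinearMap.range Q.encode

/-- The operator `E` on `n` qudits acts only on the qudits with position in `S`: it is
`M ⊗ 1` for an operator `M` on these qudits. -/
def ActsOn (S : Finset (Fin n)) (E : Matrix (Fin n → A) (Fin n → A) ℂ) : Prop :=
  ∃ M : Matrix (S → A) (S → A) ℂ, ∀ x y : Fin n → A,
    E x y = if ∀ i, i ∉ S → x i = y i then M (fun i => x i) (fun i => y i) else 0

/-- The code detects the error `E` on the transmitted qudits (the receiver's halves of the pairs
are free of errors): `P (E ⊗ 1) P = z P` for a scalar `z`, where `P` is the orthogonal projection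
onto the code space. -/
def Detects (Q : EAQECC A n k c) (E : Matrix (Fin n → A) (Fin n → A) ℂ) : Prop :=
  ∃ z : ℂ, ∀ φ ∈ Q.codeSpace, ∀ ψ ∈ Q.codeSpace,
    star φ ⬝ᵥ ((E ⊗ₖ (1 : Matrix (Fin c → A) (Fin c → A) ℂ)) *ᵥ ψ) = z * (star φ ⬝ᵥ ψ)

/-- The code has minimum distance `d`: it detects every error that acts on fewer than `d` of the
transmitted qudits, but not every error that acts on `d` of them. -/
def HasMinDist (Q : EAQECC A n k c) (d : ℕ) : Prop :=
  (∀ (S : Finset (Fin n)) (E : Matrix (Fin n → A) (Fin n → A) ℂ),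
      S.card < d → ActsOn S E → Q.Detects E) ∧
    ∃ (S : Finset (Fin n)) (E : Matrix (Fin n → A) (Fin n → A) ℂ),
      S.card = d ∧ ActsOn S E ∧ ¬ Q.Detects E

end EAQECC

/-- There is an EAQMDS code with parameters `[[n, k, d; c]]_q`: an entanglement-assisted code with
these parameters, with `d ≤ (n + 2) / 2`, that meets the entanglement-assisted Singleton bound
`n + c - k ≥ 2 (d - 1)` with equality. -/
def ExistsEAQMDS (q n k d c : ℕ) : Prop :=
  (∃ Q : EAQECC (Fin q) n k c, Q.HasMinDist d) ∧
    (d : ℚ) ≤ ((n : ℚ) + 2) / 2 ∧ (n : ℚ) + c - k = 2 * ((d : ℚ) - 1)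

/-! Write `q = 10u + 7`. Then `n = 10u² + 14u + 5 = a² + b²` with `a = u + 1`, `b = 3u + 2`, and `s
= 5n`. On exponents `s + r t`, with `t` modulo `n`, multiplication by `q²` is `t ↦ -t` and by `-q`
is `t ↦ -q t` (`exponent_mul_sq`, `neg_mul_exponent`). Hence `Z` is the interval `|t| ≤ T` with `T =
3u + 1 + λ`, and an element of `Z ∩ -qZ` is a `t` with `t + q t' ≡ 0` for some `t'` in the same
interval. The pairs `(t', -t)` form the square lattice spanned by `(a, b)` and `(-b, a)`; since `T <
a + b`, only the origin and the four shortest vectors fit (`small_solution_cases`), and since `T ≥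
b` they all do. This gives the five elements.

As `Z` consists of `m = 2T + 1` consecutive exponents, the code has dimension `n - m`, and the BCH
bound gives weight at least `m + 1`: it is MDS. Over the extension field a parity check matrix is
equivalent to a Vandermonde matrix `W`. The entries of `W W*` are geometric sums of `n`-th roots of
unity, so `W W*` is `n` times a partial permutation matrix whose rank counts `Z ∩ -qZ`
(`rank_mul_hermTranspose`).

For the quantum code, the Hermitian dual of `C`, read over the fixed field of `x ↦ x ^ q`, is a
subspace `D` whose symplectic complement is `C` and whose quotient by its radical has dimension `2
rank (H H*)`. A maximal isotropic `I ≤ D` defines a stabilizer code, and the Weyl operators of a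
complement of `I` in `D` encode the shared pairs (`exists_eaqecc_hasMinDist`). Errors outside the
complement of `D` are detected, and those in it have weight at least `d` if nonzero. Exactness of
the distance needs a minimum weight word of `C` outside its Hermitian dual
(`exists_hammingNorm_eq_and_sum_ne_zero`). -/

/-! ### Detection in terms of the encoding isometry -/

namespace EAQECC

variable {A : Type*} [Fintype A] [DecidableEq A] {n k c : ℕ}

/-- The part of the encoding isometry that belongs to the basis state `b` of the `c` pairs. -/
def block (Q : EAQECC A n k c) (b : Fin c → A) : Matrix (Fin n → A) (Fin k → A) ℂ :=
  Matrix.of fun x u => Q.encoder x (u, b)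

theorem sum_block_conjTranspose_mul_block (Q : EAQECC A n k c) :
    ∑ b, (Q.block b)ᴴ * Q.block b = (((Fintype.card A : ℂ)) ^ c) • 1 := by
  have h : ∀ b, (Q.block b)ᴴ * Q.block b = 1 := by
    intro b
    ext u v
    have := congrFun (congrFun Q.isometry (u, b)) (v, b)
    simp only [Matrix.mul_apply, Matrix.conjTranspose_apply, Matrix.one_apply, Prod.mk.injEq,
      and_true] at this
    simpa [Matrix.mul_apply, block, Matrix.one_apply] using this
  simp only [h, Finset.sum_const, Finset.card_univ, Fintype.card_fun, Fintype.card_fin]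
  rw [← Nat.cast_smul_eq_nsmul ℂ]
  push_cast
  rfl

theorem encode_apply (Q : EAQECC A n k c) (ψ : (Fin k → A) → ℂ) (p : (Fin n → A) × (Fin c → A)) :
    Q.encode ψ p = ((Real.sqrt ((Fintype.card A : ℝ) ^ c) : ℝ) : ℂ)⁻¹ * (Q.block p.2 *ᵥ ψ) p.1 :=
  rfl

theorem star_encode_dotProduct (Q : EAQECC A n k c) (E : Matrix (Fin n → A) (Fin n → A) ℂ)
    (φ ψ : (Fin k → A) → ℂ) :
    star (Q.encode φ) ⬝ᵥ
        ((E ⊗ₖ (1 : Matrix (Fin c → A) (Fin c → A) ℂ)) *ᵥ Q.encode ψ) =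
      ((Fintype.card A : ℂ) ^ c)⁻¹ *
        (star φ ⬝ᵥ ((∑ b, (Q.block b)ᴴ * E * Q.block b) *ᵥ ψ)) := by
  set t : ℂ := ((Real.sqrt ((Fintype.card A : ℝ) ^ c) : ℝ) : ℂ)⁻¹ with ht
  have htt : star t * t = ((Fintype.card A : ℂ) ^ c)⁻¹ := by
    rw [ht, star_inv₀, Complex.star_def, Complex.conj_ofReal, ← mul_inv, ← Complex.ofReal_mul,
      Real.mul_self_sqrt (by positivity)]
    push_cast
    rfl
  have hmul : ∀ x b, ((E ⊗ₖ (1 : Matrix (Fin c → A) (Fin c → A) ℂ)) *ᵥ Q.encode ψ) (x, b) =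
      t * ((E * Q.block b) *ᵥ ψ) x := by
    intro x b
    rw [← Matrix.mulVec_mulVec]
    simp only [Matrix.mulVec, dotProduct, Fintype.sum_prod_type, Matrix.kroneckerMap_apply,
      Matrix.one_apply, encode_apply, ← ht, mul_ite, mul_one, mul_zero, ite_mul, zero_mul,
      Finset.sum_ite_eq, Finset.mem_univ, if_true]
    rw [Finset.mul_sum]
    exact Finset.sum_congr rfl fun y _ => by ring
  have hb : ∀ b, star φ ⬝ᵥ (((Q.block b)ᴴ * E * Q.block b) *ᵥ ψ) =
      ∑ x, star ((Q.block b *ᵥ φ) x) * ((E * Q.block b) *ᵥ ψ) x := by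
    intro b
    rw [Matrix.mul_assoc, ← Matrix.mulVec_mulVec, Matrix.dotProduct_mulVec,
      ← Matrix.star_mulVec]
    rfl
  rw [Matrix.sum_mulVec, dotProduct_sum, Finset.mul_sum]
  simp only [hb]
  rw [dotProduct, Fintype.sum_prod_type_right]
  refine Finset.sum_congr rfl fun b _ => ?_
  rw [Finset.mul_sum]
  refine Finset.sum_congr rfl fun x _ => ?_
  rw [hmul, Pi.star_apply, encode_apply, ← ht, ← htt, star_mul]
  ring

/-- Tracing out the receiver's half of the maximally entangled state turns `P (E ⊗ 1) P` into the
average of the compressions of `E` to the blocks, up to the encoding isometry. -/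
theorem detects_iff [Nonempty A] (Q : EAQECC A n k c) (E : Matrix (Fin n → A) (Fin n → A) ℂ) :
    Q.Detects E ↔ ∃ z : ℂ, ∑ b, (Q.block b)ᴴ * E * Q.block b = z • 1 := by
  have hN : ((Fintype.card A : ℂ)) ^ c ≠ 0 := pow_ne_zero _ (by simp)
  have hinner : ∀ φ ψ, star (Q.encode φ) ⬝ᵥ Q.encode ψ = star φ ⬝ᵥ ψ := by
    intro φ ψ
    have := Q.star_encode_dotProduct 1 φ ψ
    simp only [Matrix.one_kronecker_one, Matrix.one_mulVec, Matrix.mul_one,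
      sum_block_conjTranspose_mul_block, Matrix.smul_mulVec, dotProduct_smul, smul_eq_mul] at this
    rw [this, inv_mul_cancel_left₀ hN]
  constructor
  · rintro ⟨z, hz⟩
    refine ⟨(Fintype.card A : ℂ) ^ c * z, ?_⟩
    ext u v
    have := hz _ ⟨Pi.single u 1, rfl⟩ _ ⟨Pi.single v 1, rfl⟩
    rw [star_encode_dotProduct, hinner, inv_mul_eq_iff_eq_mul₀ hN] at this
    simpa [Matrix.one_apply, Pi.single_apply, mul_assoc, Pi.star_single, eq_comm] using this
  · rintro ⟨z, hz⟩
    refine ⟨((Fintype.card A : ℂ) ^ c)⁻¹ * z, ?_⟩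
    rintro _ ⟨φ, rfl⟩ _ ⟨ψ, rfl⟩
    rw [star_encode_dotProduct, hinner, hz, Matrix.smul_mulVec, Matrix.one_mulVec, dotProduct_smul,
      smul_eq_mul, mul_assoc]

/-- The detected errors form a subspace. -/
theorem Detects.of_mem_span [Nonempty A] {Q : EAQECC A n k c}
    {s : Set (Matrix (Fin n → A) (Fin n → A) ℂ)} (hs : ∀ E ∈ s, Q.Detects E)
    {E : Matrix (Fin n → A) (Fin n → A) ℂ} (hE : E ∈ Submodule.span ℂ s) : Q.Detects E := by
  induction hE using Submodule.span_induction with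
  | mem E h => exact hs E h
  | zero => exact (Q.detects_iff 0).2 ⟨0, by simp⟩
  | add E E' _ _ h h' =>
    obtain ⟨z, hz⟩ := (Q.detects_iff E).1 h
    obtain ⟨z', hz'⟩ := (Q.detects_iff E').1 h'
    exact (Q.detects_iff _).2 ⟨z + z', by
      simp only [Matrix.mul_add, Matrix.add_mul, Finset.sum_add_distrib, hz, hz', add_smul]⟩
  | smul a E _ h =>
    obtain ⟨z, hz⟩ := (Q.detects_iff E).1 h
    exact (Q.detects_iff _).2 ⟨a * z, by
      simp only [Matrix.mul_smul, Matrix.smul_mul, ← Finset.smul_sum, hz, mul_smul]⟩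

end EAQECC

/-! ### The symplectic form and Weyl operators -/

section Weyl

set_option linter.unusedSectionVars false

variable {A L : Type*} [Field L] {n : ℕ}

/-- The standard symplectic form on `(L × L) ^ n`. -/
def symplecticForm (L : Type*) [Field L] (n : ℕ) : LinearMap.BilinForm L (Fin n → L × L) :=
  LinearMap.mk₂ L (fun e f => ∑ i, ((e i).2 * (f i).1 - (f i).2 * (e i).1))
    (fun e e' f => by
      simp only [Pi.add_apply, Prod.fst_add, Prod.snd_add, ← Finset.sum_add_distrib]
      exact Finset.sum_congr rfl fun i _ => by ring)
    (fun a e f => by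
      simp only [Pi.smul_apply, Prod.smul_fst, Prod.smul_snd, smul_eq_mul, Finset.mul_sum]
      exact Finset.sum_congr rfl fun i _ => by ring)
    (fun e f f' => by
      simp only [Pi.add_apply, Prod.fst_add, Prod.snd_add, ← Finset.sum_add_distrib]
      exact Finset.sum_congr rfl fun i _ => by ring)
    (fun a e f => by
      simp only [Pi.smul_apply, Prod.smul_fst, Prod.smul_snd, smul_eq_mul, Finset.mul_sum]
      exact Finset.sum_congr rfl fun i _ => by ring)

theorem symplecticForm_apply (e f : Fin n → L × L) :
    symplecticForm L n e f = ∑ i, ((e i).2 * (f i).1 - (f i).2 * (e i).1) := rfl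

theorem symplecticForm_isAlt : (symplecticForm L n).IsAlt := fun e => by
  rw [symplecticForm_apply]
  exact Finset.sum_eq_zero fun i _ => sub_self _

theorem symplecticForm_swap (e f : Fin n → L × L) :
    symplecticForm L n f e = -symplecticForm L n e f := by
  rw [← symplecticForm_isAlt.neg_eq f e, neg_neg]

theorem exists_symplecticForm_ne_zero {e : Fin n → L × L} (he : e ≠ 0) :
    ∃ f, symplecticForm L n e f ≠ 0 := by
  obtain ⟨i, hi⟩ := Function.ne_iff.1 he
  by_cases h : (e i).2 = 0
  · have h1 : (e i).1 ≠ 0 := fun h1 => hi (Prod.ext h1 h)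
    refine ⟨Pi.single i (0, 1), ?_⟩
    rw [symplecticForm_apply, Finset.sum_eq_single i]
    · simpa using h1
    · intro j _ hj
      simp [Pi.single_eq_of_ne hj]
    · simp
  · refine ⟨Pi.single i (1, 0), ?_⟩
    rw [symplecticForm_apply, Finset.sum_eq_single i]
    · simpa using h
    · intro j _ hj
      simp [Pi.single_eq_of_ne hj]
    · simp

theorem symplecticForm_nondegenerate : (symplecticForm L n).Nondegenerate := by
  have h1 : ∀ e, (∀ f, symplecticForm L n e f = 0) → e = 0 := by
    intro e h
    by_contra he
    obtain ⟨f, hf⟩ := exists_symplecticForm_ne_zero he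
    exact hf (h f)
  refine ⟨h1, fun e h => h1 e fun f => ?_⟩
  rw [symplecticForm_swap, h f, neg_zero]

variable (ε : A ≃ L) (χ : AddChar L ℂ)

open Classical in
/-- The Weyl operator of the error `e`; its component `(a, b)` in a position shifts the label there
by `a` and multiplies by a phase that depends on `b`. The alphabet `A` is identified with `L`. -/
noncomputable def weyl (e : Fin n → L × L) : Matrix (Fin n → A) (Fin n → A) ℂ :=
  Matrix.of fun x y => if ∀ i, ε (x i) = ε (y i) + (e i).1
    then χ (∑ i, (e i).2 * (ε (x i) + ε (y i))) else 0

open Classical in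
theorem weyl_apply (e : Fin n → L × L) (x y : Fin n → A) :
    weyl ε χ e x y = if ∀ i, ε (x i) = ε (y i) + (e i).1
      then χ (∑ i, (e i).2 * (ε (x i) + ε (y i))) else 0 := by
  simp only [weyl, Matrix.of_apply]

theorem weyl_apply_of_forall {e : Fin n → L × L} {x y : Fin n → A}
    (h : ∀ i, ε (x i) = ε (y i) + (e i).1) :
    weyl ε χ e x y = χ (∑ i, (e i).2 * (ε (x i) + ε (y i))) := by
  rw [weyl_apply, if_pos h]

theorem weyl_apply_of_not_forall {e : Fin n → L × L} {x y : Fin n → A}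
    (h : ¬ ∀ i, ε (x i) = ε (y i) + (e i).1) : weyl ε χ e x y = 0 := by
  rw [weyl_apply, if_neg h]

variable [Fintype A] [DecidableEq A]

theorem weyl_zero : weyl ε χ (0 : Fin n → L × L) = 1 := by
  ext x y
  rw [weyl_apply, Matrix.one_apply]
  simp [← funext_iff]

/-- The phase of `weyl` uses the symmetric combination of row and column labels, which makes the
cocycle exactly the symplectic form and the adjoint exactly the operator of `-e`. The commutation
phase is then `χ` of twice the form, hence the restriction to odd characteristic below. -/
theorem weyl_mul (e f : Fin n → L × L) :
    weyl ε χ e * weyl ε χ f = χ (symplecticForm L n e f) • weyl ε χ (e + f) := by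
  ext x y
  rw [Matrix.mul_apply, Finset.sum_eq_single fun i => ε.symm (ε (y i) + (f i).1)]
  · rw [weyl_apply_of_forall ε χ (e := f) fun i => Equiv.apply_symm_apply _ _, Matrix.smul_apply,
      smul_eq_mul]
    by_cases h : ∀ i, ε (x i) = ε (y i) + ((e + f) i).1
    · rw [weyl_apply_of_forall ε χ h, weyl_apply_of_forall, ← AddChar.map_add_eq_mul,
        ← AddChar.map_add_eq_mul, symplecticForm_apply, ← Finset.sum_add_distrib,
        ← Finset.sum_add_distrib]
      · congr 1
        refine Finset.sum_congr rfl fun i _ => ?_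
        rw [h i, Equiv.apply_symm_apply, Pi.add_apply, Prod.fst_add, Prod.snd_add]
        ring
      · intro i
        rw [h i, Equiv.apply_symm_apply, Pi.add_apply, Prod.fst_add]
        ring
    · rw [weyl_apply_of_not_forall ε χ h, weyl_apply_of_not_forall, zero_mul, mul_zero]
      refine fun h' => h fun i => ?_
      rw [h' i, Equiv.apply_symm_apply, Pi.add_apply, Prod.fst_add]
      ring
  · intro z _ hz
    rw [weyl_apply ε χ f, if_neg, mul_zero]
    intro h
    exact hz (funext fun i => by rw [← h i, Equiv.symm_apply_apply])
  · simp

theorem weyl_conjTranspose [Finite L] (e : Fin n → L × L) :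
    (weyl ε χ e)ᴴ = weyl ε χ (-e) := by
  ext x y
  rw [Matrix.conjTranspose_apply]
  have h : (∀ i, ε (y i) = ε (x i) + (e i).1) ↔ ∀ i, ε (x i) = ε (y i) + ((-e) i).1 := by
    refine forall_congr' fun i => ?_
    rw [Pi.neg_apply, Prod.fst_neg, ← sub_eq_add_neg, eq_sub_iff_add_eq, eq_comm]
  by_cases h' : ∀ i, ε (y i) = ε (x i) + (e i).1
  · rw [weyl_apply_of_forall ε χ h', weyl_apply_of_forall ε χ (h.1 h'), Complex.star_def,
      ← AddChar.map_neg_eq_conj, ← Finset.sum_neg_distrib]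
    congr 1
    refine Finset.sum_congr rfl fun i _ => ?_
    rw [Pi.neg_apply, Prod.snd_neg]
    ring
  · rw [weyl_apply_of_not_forall ε χ h', weyl_apply_of_not_forall ε χ fun h0 => h' (h.2 h0),
      star_zero]

theorem weyl_neg_mul_mul (f e : Fin n → L × L) :
    weyl ε χ (-f) * weyl ε χ e * weyl ε χ f = χ (2 * symplecticForm L n e f) • weyl ε χ e := by
  rw [weyl_mul, Matrix.smul_mul, weyl_mul, smul_smul, ← AddChar.map_add_eq_mul]
  congr 2
  · rw [map_add, map_neg, LinearMap.add_apply, LinearMap.neg_apply, LinearMap.neg_apply,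
      symplecticForm_isAlt f, symplecticForm_swap e f]
    ring
  · abel

theorem weyl_mul_comm (e f : Fin n → L × L) :
    weyl ε χ e * weyl ε χ f =
      χ (2 * symplecticForm L n e f) • (weyl ε χ f * weyl ε χ e) := by
  rw [weyl_mul, weyl_mul, smul_smul, ← AddChar.map_add_eq_mul, symplecticForm_swap e f,
    add_comm e f]
  congr 2
  ring

theorem weyl_neg_mul_self (f : Fin n → L × L) : weyl ε χ (-f) * weyl ε χ f = 1 := by
  have h : symplecticForm L n (-f) f = 0 := by
    rw [map_neg, LinearMap.neg_apply, symplecticForm_isAlt f, neg_zero]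
  rw [weyl_mul, h, AddChar.map_zero_eq_one, one_smul, neg_add_cancel, weyl_zero]

variable {χ}

/-- A nonzero value of the symplectic form gives a nontrivial phase after rescaling. -/
theorem exists_addChar_two_mul_ne_one (hχ : χ ≠ 1) (h2 : (2 : L) ≠ 0) {t : L} (ht : t ≠ 0) :
    ∃ a : L, χ (2 * (a * t)) ≠ 1 := by
  obtain ⟨x, hx⟩ := AddChar.ne_one_iff.1 hχ
  refine ⟨x * (2 * t)⁻¹, ?_⟩
  rwa [show 2 * (x * (2 * t)⁻¹ * t) = x by field_simp]

/-- Conjugation by a suitable Weyl operator preserves the trace but multiplies this operator by a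
phase different from `1`. -/
theorem trace_weyl (hχ : χ ≠ 1) (h2 : (2 : L) ≠ 0) {e : Fin n → L × L} (he : e ≠ 0) :
    (weyl ε χ e).trace = 0 := by
  obtain ⟨f, hf⟩ := exists_symplecticForm_ne_zero he
  obtain ⟨a, ha⟩ := exists_addChar_two_mul_ne_one hχ h2 hf
  have h := congrArg Matrix.trace (weyl_neg_mul_mul ε χ (a • f) e)
  have h' := weyl_neg_mul_self ε χ (-(a • f))
  rw [neg_neg] at h'
  rw [Matrix.mul_assoc, Matrix.trace_mul_comm, Matrix.mul_assoc, h', Matrix.mul_one,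
    Matrix.trace_smul, map_smul, smul_eq_mul, smul_eq_mul] at h
  by_contra h0
  exact ha (mul_right_cancel₀ h0 (by rw [one_mul, ← h]))

/-- Weyl operators act on the support of the error. -/
theorem actsOn_weyl {S : Finset (Fin n)} {e : Fin n → L × L} (he : ∀ i, i ∉ S → e i = 0) :
    EAQECC.ActsOn S (weyl ε χ e) := by
  classical
  refine ⟨Matrix.of fun u v => if ∀ i : S, ε (u i) = ε (v i) + (e i).1
    then χ (∑ i : S, (e i).2 * (ε (u i) + ε (v i))) else 0, fun x y => ?_⟩
  rw [weyl_apply, Matrix.of_apply]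
  have hsum : ∑ i : S, (e i).2 * (ε (x i) + ε (y i)) = ∑ i, (e i).2 * (ε (x i) + ε (y i)) := by
    rw [Finset.sum_coe_sort S fun i => (e i).2 * (ε (x i) + ε (y i))]
    refine Finset.sum_subset (Finset.subset_univ _) fun i _ hi => ?_
    rw [he i hi, Prod.snd_zero, zero_mul]
  rw [hsum, ← ite_and]
  refine if_congr ?_ rfl rfl
  constructor
  · intro h
    refine ⟨fun i hi => ?_, fun i => h i⟩
    have := h i
    rwa [he i hi, Prod.fst_zero, add_zero, ε.injective.eq_iff] at this
  · rintro ⟨h1, h2⟩ i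
    by_cases hi : i ∈ S
    · exact h2 ⟨i, hi⟩
    · rw [h1 i hi, he i hi, Prod.fst_zero, add_zero]

theorem sum_addChar_sum_mul [Fintype L] [DecidableEq L] {ι : Type*} [Fintype ι] [DecidableEq ι]
    (hχ : χ.IsPrimitive) (v : ι → L) :
    ∑ b : ι → L, χ (∑ i, b i * v i) = if v = 0 then (Fintype.card L : ℂ) ^ Fintype.card ι else 0 := by
  have h : ∀ b : ι → L, χ (∑ i, b i * v i) = ∏ i, χ (b i * v i) := by
    intro b
    induction (Finset.univ : Finset ι) using Finset.induction_on with
    | empty => simp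
    | insert i s hi ih =>
      rw [Finset.sum_insert hi, Finset.prod_insert hi, AddChar.map_add_eq_mul, ih]
  simp only [h]
  rw [← Fintype.piFinset_univ, ← Finset.prod_univ_sum (fun _ => Finset.univ) fun i b => χ (b * v i)]
  simp only [AddChar.sum_mulShift _ hχ]
  split_ifs with hv
  · simp [hv]
  · obtain ⟨i, hi⟩ := Function.ne_iff.1 hv
    exact Finset.prod_eq_zero (Finset.mem_univ i) (by simpa using hi)

/-- Every operator that acts on `S` is a combination of Weyl operators of errors supported
on `S`. -/
theorem mem_span_weyl [Fintype L] (hχ : χ.IsPrimitive) (h2 : (2 : L) ≠ 0) {S : Finset (Fin n)}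
    {E : Matrix (Fin n → A) (Fin n → A) ℂ} (hE : EAQECC.ActsOn S E) :
    E ∈ Submodule.span ℂ (weyl ε χ '' {e : Fin n → L × L | ∀ i, i ∉ S → e i = 0}) := by
  classical
  obtain ⟨M, hM⟩ := hE
  let extend (a b : S → L) : Fin n → L × L := fun i => if h : i ∈ S then (a ⟨i, h⟩, b ⟨i, h⟩) else 0
  let N : ℂ := (Fintype.card L : ℂ) ^ Fintype.card S
  have hN : N ≠ 0 := pow_ne_zero _ (by simp)
  -- Fourier inversion: each matrix unit with row `p` and column `w` on `S` is an average over `b`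
  -- of Weyl operators with shift `p - w`.
  have key : E = ∑ p : S → A, ∑ w : S → A, ∑ b : S → L,
      (M p w * N⁻¹ * χ (-∑ i, b i * (ε (p i) + ε (w i)))) •
        weyl ε χ (extend (fun i => ε (p i) - ε (w i)) b) := by
    ext x y
    have hterm : ∀ (p w : S → A) (b : S → L),
        weyl ε χ (extend (fun i => ε (p i) - ε (w i)) b) x y =
        if (∀ i, i ∉ S → x i = y i) ∧ ∀ i : S, ε (x i) = ε (y i) + (ε (p i) - ε (w i)) then
          χ (∑ i : S, b i * (ε (x i) + ε (y i))) else 0 := by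
      intro p w b
      rw [weyl_apply]
      refine if_congr ?_ ?_ rfl
      · constructor
        · intro h
          refine ⟨fun i hi => ?_, fun i => ?_⟩
          · have := h i
            simpa [extend, hi] using this
          · have := h i
            simpa [extend] using this
        · rintro ⟨h1, h2⟩ i
          by_cases hi : i ∈ S
          · simpa [extend, hi] using h2 ⟨i, hi⟩
          · simp [extend, hi, h1 i hi]
      · congr 1
        rw [← Finset.sum_subset (Finset.subset_univ S), ← Finset.sum_coe_sort S]
        · refine Finset.sum_congr rfl fun i _ => ?_
          simp [extend]
        · intro i _ hi
          simp [extend, hi]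
    have hsum : ∀ p w : S → A, ∑ b : S → L,
        (M p w * N⁻¹ * χ (-∑ i, b i * (ε (p i) + ε (w i)))) *
          weyl ε χ (extend (fun i => ε (p i) - ε (w i)) b) x y =
        if (∀ i, i ∉ S → x i = y i) ∧ p = (fun i : S => x i) ∧ w = (fun i : S => y i) then M p w else 0 := by
      intro p w
      by_cases h : (∀ i, i ∉ S → x i = y i) ∧ ∀ i : S, ε (x i) = ε (y i) + (ε (p i) - ε (w i))
      · have hs : ∀ b : S → L, (M p w * N⁻¹ * χ (-∑ i, b i * (ε (p i) + ε (w i)))) *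
            weyl ε χ (extend (fun i => ε (p i) - ε (w i)) b) x y =
            M p w * N⁻¹ * χ (∑ i, b i * (ε (x i) + ε (y i) - (ε (p i) + ε (w i)))) := by
          intro b
          rw [hterm, if_pos h, mul_assoc, ← AddChar.map_add_eq_mul]
          congr 2
          rw [← Finset.sum_neg_distrib, ← Finset.sum_add_distrib]
          exact Finset.sum_congr rfl fun i _ => by ring
        simp only [hs]
        rw [← Finset.mul_sum, sum_addChar_sum_mul hχ]
        by_cases hp : p = (fun i : S => x i) ∧ w = (fun i : S => y i)
        · rw [if_pos, if_pos ⟨h.1, hp⟩, mul_assoc, inv_mul_cancel₀ hN, mul_one]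
          funext i
          simp [hp.1, hp.2]
        · rw [if_neg, if_neg fun h' => hp h'.2, mul_zero]
          intro h0
          apply hp
          -- The character sum fixes `p + w` and the shift fixes `p - w`; as `2` is invertible, both
          -- labels are determined.
          have hi : ∀ i : S, ε (p i) = ε (x i) ∧ ε (w i) = ε (y i) := by
            intro i
            have e1 := congrFun h0 i
            have e2 := h.2 i
            simp only [Pi.zero_apply] at e1
            constructor
            · apply mul_left_cancel₀ h2
              linear_combination -e1 - e2
            · apply mul_left_cancel₀ h2
              linear_combination -e1 + e2
          exact ⟨funext fun i => ε.injective (hi i).1, funext fun i => ε.injective (hi i).2⟩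
      · rw [if_neg]
        · refine Finset.sum_eq_zero fun b _ => ?_
          rw [hterm, if_neg h, mul_zero]
        · rintro ⟨h1, h2, h3⟩
          exact h ⟨h1, fun i => by rw [h2, h3]; ring⟩
    simp only [Matrix.sum_apply, Matrix.smul_apply, smul_eq_mul, hsum]
    rw [hM]
    by_cases h : ∀ i, i ∉ S → x i = y i
    · simp only [ite_and]
      simp
    · simp [h]
  rw [key]
  refine Submodule.sum_mem _ fun p _ => Submodule.sum_mem _ fun w _ => Submodule.sum_mem _
    fun b _ => Submodule.smul_mem _ _ (Submodule.subset_span ⟨_, fun i hi => ?_, rfl⟩)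
  simp [extend, hi]

end Weyl

/-! ### Orthonormal bases of the range of a projection -/

/-- An orthogonal projection of trace `|Y|` is `J Jᴴ` for an isometry `J` from `ℂ ^ Y`. -/
theorem exists_isometry_of_isHermitian_of_isIdempotentElem {X Y : Type*} [Fintype X]
    [DecidableEq X] [Fintype Y] [DecidableEq Y] {P : Matrix X X ℂ} (hP : P.IsHermitian)
    (hPP : P * P = P) (htr : P.trace = Fintype.card Y) :
    ∃ J : Matrix X Y ℂ, Jᴴ * J = 1 ∧ J * Jᴴ = P := by
  let U : Matrix X X ℂ := (hP.eigenvectorUnitary : Matrix X X ℂ)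
  let D : X → ℂ := fun i => (hP.eigenvalues i : ℂ)
  have hUU : Uᴴ * U = 1 := Unitary.coe_star_mul_self hP.eigenvectorUnitary
  have hUU' : U * Uᴴ = 1 := Unitary.coe_mul_star_self hP.eigenvectorUnitary
  have hspec : P = U * Matrix.diagonal D * Uᴴ := by
    have := hP.spectral_theorem
    rwa [Unitary.conjStarAlgAut_apply] at this
  have hdiag : Matrix.diagonal D = Uᴴ * P * U := by
    rw [hspec]
    calc Matrix.diagonal D = (Uᴴ * U) * Matrix.diagonal D * (Uᴴ * U) := by simp [hUU]
      _ = _ := by simp only [Matrix.mul_assoc]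
  have hsq : ∀ i, D i * D i = D i := by
    intro i
    have : Matrix.diagonal D * Matrix.diagonal D = Matrix.diagonal D := by
      rw [hdiag]
      calc Uᴴ * P * U * (Uᴴ * P * U) = Uᴴ * (P * (U * Uᴴ) * P) * U := by
            simp only [Matrix.mul_assoc]
        _ = _ := by rw [hUU', Matrix.mul_one, hPP]
    rw [Matrix.diagonal_mul_diagonal] at this
    exact congrFun (Matrix.diagonal_injective this) i
  have h01 : ∀ i, D i = if D i = 1 then 1 else 0 := by
    intro i
    split_ifs with h
    · exact h
    · by_contra h0
      exact h (mul_left_cancel₀ h0 (by rw [hsq, mul_one]))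
  have hcard : Fintype.card Y = Fintype.card {i // D i = 1} := by
    have h : P.trace = ∑ i, D i := by
      rw [hspec, Matrix.trace_mul_comm, ← Matrix.mul_assoc, hUU, Matrix.one_mul,
        Matrix.trace_diagonal]
    rw [htr, Finset.sum_congr rfl fun i _ => h01 i, Finset.sum_boole] at h
    rw [Fintype.card_subtype]
    exact_mod_cast h
  -- The eigenvalues are `0` or `1`, so the trace counts the eigenvectors with eigenvalue `1`; these
  -- are the columns of `J`.
  let σ : Y ≃ {i // D i = 1} := Fintype.equivOfCardEq hcard
  refine ⟨U.submatrix id fun y => (σ y : X), ?_, ?_⟩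
  · ext y z
    have := congrFun (congrFun hUU (σ y)) (σ z)
    rw [Matrix.mul_apply] at this ⊢
    simp only [Matrix.conjTranspose_apply, Matrix.submatrix_apply, id] at this ⊢
    rw [this, Matrix.one_apply, Matrix.one_apply]
    simp [Subtype.ext_iff.symm]
  · ext x x'
    conv_rhs => rw [hspec, Matrix.mul_apply]
    rw [Matrix.mul_apply]
    simp only [Matrix.conjTranspose_apply, Matrix.submatrix_apply, id, Matrix.mul_diagonal]
    rw [Equiv.sum_comp σ fun i : {i // D i = 1} => U x i * star (U x' i),
      ← Finset.sum_subtype (Finset.univ.filter fun i => D i = 1) (by simp)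
        fun i => U x i * star (U x' i), Finset.sum_filter]
    refine Finset.sum_congr rfl fun i _ => ?_
    by_cases h : D i = 1
    · rw [if_pos h, h, mul_one]
    · have h0 := h01 i
      rw [if_neg h] at h0
      rw [if_neg h, h0, mul_zero, zero_mul]

/-! ### Maximal isotropic subspaces -/

section Isotropic

open Module

variable {L V : Type*} [Field L] [AddCommGroup V] [Module L V] [FiniteDimensional L V]

/-- A maximal isotropic subspace of `D` contains all vectors of `D` orthogonal to it. -/
theorem exists_maximal_isotropic {B : LinearMap.BilinForm L V} (hB : B.IsAlt)
    (D : Submodule L V) : ∃ I ≤ D, I ≤ B.orthogonal I ∧ D ⊓ B.orthogonal I ≤ I := by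
  obtain ⟨I, ⟨hID, hII⟩, hmax⟩ := WellFounded.has_min
    (wellFounded_gt : WellFounded fun x y : Submodule L V => x > y)
    {I | I ≤ D ∧ I ≤ B.orthogonal I} ⟨⊥, bot_le, bot_le⟩
  refine ⟨I, hID, hII, fun x hx => ?_⟩
  by_contra hxI
  obtain ⟨hxD, hxO⟩ := Submodule.mem_inf.1 hx
  have hswap : ∀ u v, B u v = 0 → B v u = 0 := fun u v h => by
    rw [← hB.neg_eq, h, neg_zero]
  refine hmax (I ⊔ Submodule.span L {x}) ⟨?_, ?_⟩ ?_
  · exact sup_le hID ((Submodule.span_singleton_le_iff_mem _ _).2 hxD)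
  · intro v hv w hw
    obtain ⟨v₁, hv₁, v₂, hv₂, rfl⟩ := Submodule.mem_sup.1 hv
    obtain ⟨w₁, hw₁, w₂, hw₂, rfl⟩ := Submodule.mem_sup.1 hw
    obtain ⟨a, rfl⟩ := Submodule.mem_span_singleton.1 hv₂
    obtain ⟨b, rfl⟩ := Submodule.mem_span_singleton.1 hw₂
    have h1 : B w₁ v₁ = 0 := hII hv₁ w₁ hw₁
    have h2 : B w₁ x = 0 := hxO w₁ hw₁
    have h3 : B x v₁ = 0 := hswap _ _ (hxO v₁ hv₁)
    have h4 : B x x = 0 := hB x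
    change B (w₁ + b • x) (v₁ + a • x) = 0
    simp [h1, h2, h3, h4]
  · refine lt_of_le_of_ne le_sup_left fun h => hxI ?_
    rw [h]
    exact Submodule.mem_sup_right (Submodule.mem_span_singleton_self x)

/-- Maximality gives `I = (I + D^⊥)^⊥` and `I ∩ D^⊥ = D ∩ D^⊥`; the rest is dimension counting. -/
theorem two_mul_finrank_of_maximal_isotropic {B : LinearMap.BilinForm L V}
    (hB : B.Nondegenerate) (hB' : B.IsAlt) {D I : Submodule L V} (hID : I ≤ D)
    (hII : I ≤ B.orthogonal I) (hI : D ⊓ B.orthogonal I ≤ I) :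
    2 * finrank L I = finrank L D + finrank L (D ⊓ B.orthogonal D : Submodule L V) := by
  have hr : B.IsRefl := hB'.isRefl
  have hR : I ⊓ B.orthogonal D = D ⊓ B.orthogonal D := by
    apply le_antisymm (inf_le_inf_right _ hID)
    refine le_inf ?_ inf_le_right
    exact (inf_le_inf_left D (LinearMap.BilinForm.orthogonal_le hID)).trans hI
  have hO : B.orthogonal (I ⊔ B.orthogonal D) = I := by
    apply le_antisymm
    · refine le_trans (le_inf ?_ ?_) hI
      · exact (LinearMap.BilinForm.orthogonal_le le_sup_right).trans
          (LinearMap.BilinForm.orthogonal_orthogonal hB hr D).le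
      · exact LinearMap.BilinForm.orthogonal_le le_sup_left
    · intro x hx y hy
      obtain ⟨y₁, hy₁, y₂, hy₂, rfl⟩ := Submodule.mem_sup.1 hy
      have h1 : B y₁ x = 0 := hII hx y₁ hy₁
      have h2 : B y₂ x = 0 := hr _ _ (hy₂ x (hID hx))
      change B (y₁ + y₂) x = 0
      simp [h1, h2]
  have h1 := LinearMap.BilinForm.finrank_orthogonal hB (I ⊔ B.orthogonal D)
  have h2 := LinearMap.BilinForm.finrank_orthogonal hB D
  have h3 := Submodule.finrank_sup_add_finrank_inf_eq I (B.orthogonal D)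
  have h4 := Submodule.finrank_le (I ⊔ B.orthogonal D)
  have h5 := Submodule.finrank_le D
  rw [hO] at h1
  rw [hR] at h3
  omega

end Isotropic

/-! ### Stabilizer projections -/

section Stabilizer

variable {A L : Type*} [Fintype A] [DecidableEq A] [Field L] [Fintype L] {n : ℕ}
  (ε : A ≃ L) (χ : AddChar L ℂ)

open Classical in
/-- The projection onto the joint fixed space of the Weyl operators of an isotropic subspace. -/
noncomputable def stabilizerProj (I : Submodule L (Fin n → L × L)) :
    Matrix (Fin n → A) (Fin n → A) ℂ :=
  (Fintype.card I : ℂ)⁻¹ • ∑ e : I, weyl ε χ (e : Fin n → L × L)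

variable {χ} {I : Submodule L (Fin n → L × L)}

/-- Multiplication by an element of `I` only translates the sum over `I`, because isotropy makes all
phases trivial. -/
theorem weyl_mul_stabilizerProj (hI : I ≤ (symplecticForm L n).orthogonal I)
    {e : Fin n → L × L} (he : e ∈ I) :
    weyl ε χ e * stabilizerProj ε χ I = stabilizerProj ε χ I := by
  classical
  rw [stabilizerProj, Matrix.mul_smul, Finset.mul_sum]
  congr 1
  rw [← Equiv.sum_comp (Equiv.addLeft (⟨e, he⟩ : I)) fun f : I => weyl ε χ (f : Fin n → L × L)]
  refine Finset.sum_congr rfl fun f _ => ?_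
  have : symplecticForm L n e f = 0 := hI f.2 e he
  rw [weyl_mul, this, AddChar.map_zero_eq_one, one_smul]
  rfl

theorem stabilizerProj_conjTranspose :
    (stabilizerProj ε χ I)ᴴ = stabilizerProj ε χ I := by
  classical
  rw [stabilizerProj, Matrix.conjTranspose_smul, Matrix.conjTranspose_sum, star_inv₀,
    star_natCast]
  congr 1
  rw [← Equiv.sum_comp (Equiv.neg I) fun f : I => weyl ε χ (f : Fin n → L × L)]
  refine Finset.sum_congr rfl fun f _ => ?_
  rw [weyl_conjTranspose]
  rfl

theorem stabilizerProj_mul_weyl (hI : I ≤ (symplecticForm L n).orthogonal I)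
    {e : Fin n → L × L} (he : e ∈ I) :
    stabilizerProj ε χ I * weyl ε χ e = stabilizerProj ε χ I := by
  have := congrArg Matrix.conjTranspose
    (weyl_mul_stabilizerProj (χ := χ) ε hI (I.neg_mem he))
  rwa [Matrix.conjTranspose_mul, stabilizerProj_conjTranspose, weyl_conjTranspose, neg_neg] at this

theorem stabilizerProj_mul_self (hI : I ≤ (symplecticForm L n).orthogonal I) :
    stabilizerProj ε χ I * stabilizerProj ε χ I = stabilizerProj ε χ I := by
  classical
  conv_lhs =>
    congr
    rw [stabilizerProj]
  rw [Matrix.smul_mul, Finset.sum_mul]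
  rw [Finset.sum_congr rfl fun e _ => weyl_mul_stabilizerProj ε hI e.2, Finset.sum_const,
    Finset.card_univ, ← Nat.cast_smul_eq_nsmul ℂ, smul_smul, inv_mul_cancel₀, one_smul]
  exact Nat.cast_ne_zero.2 Fintype.card_ne_zero

theorem trace_weyl_mul_stabilizerProj (hχ : χ ≠ 1) (h2 : (2 : L) ≠ 0) {e : Fin n → L × L}
    (he : e ∉ I) : (weyl ε χ e * stabilizerProj ε χ I).trace = 0 := by
  classical
  rw [stabilizerProj, Matrix.mul_smul, Finset.mul_sum, Matrix.trace_smul, Matrix.trace_sum,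
    Finset.sum_eq_zero, smul_zero]
  intro f _
  rw [weyl_mul, Matrix.trace_smul, trace_weyl ε hχ h2, smul_zero]
  intro h
  apply he
  rw [eq_neg_of_add_eq_zero_left h]
  exact I.neg_mem f.2

/-- Only the identity operator contributes to the trace, so the stabilized space has dimension `|L|
^ (n - dim I)`. -/
theorem trace_stabilizerProj (hχ : χ ≠ 1) (h2 : (2 : L) ≠ 0) :
    (stabilizerProj ε χ I).trace =
      ((Fintype.card L : ℂ) ^ Module.finrank L I)⁻¹ * (Fintype.card L : ℂ) ^ n := by
  classical
  have hA : Fintype.card A = Fintype.card L := Fintype.card_congr ε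
  rw [stabilizerProj, Matrix.trace_smul, Matrix.trace_sum, Finset.sum_eq_single 0]
  · rw [Submodule.coe_zero, weyl_zero, Matrix.trace_one, smul_eq_mul,
      Module.card_eq_pow_finrank (K := L) (V := I), Fintype.card_fun, hA]
    simp
  · intro f _ hf
    exact trace_weyl ε hχ h2 fun h => hf (Subtype.ext h)
  · simp

/-- The stabilizer projection kills the errors that do not commute with the stabilizer. -/
theorem stabilizerProj_mul_weyl_mul_stabilizerProj (hχ : χ ≠ 1) (h2 : (2 : L) ≠ 0)
    (hI : I ≤ (symplecticForm L n).orthogonal I) {f : Fin n → L × L}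
    (hf : f ∉ (symplecticForm L n).orthogonal I) :
    stabilizerProj ε χ I * weyl ε χ f * stabilizerProj ε χ I = 0 := by
  rw [LinearMap.BilinForm.mem_orthogonal_iff] at hf
  push Not at hf
  obtain ⟨e, he, hef⟩ := hf
  obtain ⟨a, ha⟩ := exists_addChar_two_mul_ne_one hχ h2 hef
  have hae : a • e ∈ I := I.smul_mem a he
  -- An element of the stabilizer is absorbed by the left projection; moved past `f` into the right
  -- one, it leaves a phase different from `1`.
  have h : stabilizerProj ε χ I * weyl ε χ f * stabilizerProj ε χ I =
      χ (2 * (a * symplecticForm L n e f)) •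
        (stabilizerProj ε χ I * weyl ε χ f * stabilizerProj ε χ I) := by
    calc stabilizerProj ε χ I * weyl ε χ f * stabilizerProj ε χ I
        = stabilizerProj ε χ I * weyl ε χ (a • e) * weyl ε χ f * stabilizerProj ε χ I := by
          rw [stabilizerProj_mul_weyl ε hI hae]
      _ = χ (2 * (a * symplecticForm L n e f)) • (stabilizerProj ε χ I * weyl ε χ f *
            (weyl ε χ (a • e) * stabilizerProj ε χ I)) := by
          rw [Matrix.mul_assoc (stabilizerProj ε χ I), weyl_mul_comm, map_smul,
            LinearMap.smul_apply, smul_eq_mul, Matrix.mul_smul, Matrix.smul_mul]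
          simp only [Matrix.mul_assoc]
      _ = _ := by rw [weyl_mul_stabilizerProj ε hI hae]
  by_contra h0
  rw [← sub_eq_zero, ← one_smul ℂ (stabilizerProj ε χ I * _ * _), smul_smul, mul_one,
    ← sub_smul] at h
  rcases smul_eq_zero.1 h with h | h
  · exact ha (sub_eq_zero.1 h).symm
  · exact h0 h

/-- Errors that commute with the stabilizer commute with its projection. -/
theorem weyl_mul_stabilizerProj_comm {e : Fin n → L × L}
    (he : e ∈ (symplecticForm L n).orthogonal I) :
    weyl ε χ e * stabilizerProj ε χ I = stabilizerProj ε χ I * weyl ε χ e := by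
  classical
  rw [stabilizerProj, Matrix.mul_smul, Finset.mul_sum, Matrix.smul_mul, Finset.sum_mul]
  congr 1
  refine Finset.sum_congr rfl fun f _ => ?_
  have : symplecticForm L n f e = 0 := he f f.2
  rw [weyl_mul_comm ε χ e, symplecticForm_swap, this]
  simp

end Stabilizer

/-! ### Entanglement-assisted codes from symplectic subspaces -/

/-- A subspace `D` of `(L × L) ^ n` whose quotient by its radical has dimension `2 c` gives an
entanglement-assisted code with `c` pairs, whose minimum distance is read off the symplectic
complement of `D`. -/
theorem exists_eaqecc_hasMinDist {A L : Type*} [Fintype A] [DecidableEq A] [Field L] [Fintype L]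
    [DecidableEq L] (ε : A ≃ L) (h2 : (2 : L) ≠ 0) {n k c d : ℕ}
    (D : Submodule L (Fin n → L × L))
    (hdim : Module.finrank L D + k = n + c)
    (hrad : Module.finrank L (D ⊓ (symplecticForm L n).orthogonal D : Submodule L _) + 2 * c =
      Module.finrank L D)
    (hd : ∀ e ∈ (symplecticForm L n).orthogonal D, e ≠ 0 → d ≤ hammingNorm e)
    (hd' : ∃ e ∈ (symplecticForm L n).orthogonal D, e ∉ D ∧ hammingNorm e = d) :
    ∃ Q : EAQECC A n k c, Q.HasMinDist d := by
  classical
  let χ : AddChar L ℂ := AddChar.FiniteField.primitiveChar_to_Complex L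
  have hχ : χ.IsPrimitive := AddChar.FiniteField.primitiveChar_to_Complex_isPrimitive L
  have hχ1 : χ ≠ 1 := by
    have := hχ one_ne_zero
    rwa [AddChar.mulShift_one] at this
  have : Nonempty A := ⟨ε.symm 0⟩
  have hA : Fintype.card A = Fintype.card L := Fintype.card_congr ε
  have hq : (Fintype.card L : ℂ) ≠ 0 := by simp
  set ω := symplecticForm L n with hω
  obtain ⟨I, hID, hII, hI⟩ := exists_maximal_isotropic (symplecticForm_isAlt (L := L) (n := n)) D
  have hfinI : 2 * Module.finrank L I =
      Module.finrank L D + Module.finrank L (D ⊓ ω.orthogonal D : Submodule L _) :=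
    two_mul_finrank_of_maximal_isotropic symplecticForm_nondegenerate symplecticForm_isAlt hID hII hI
  obtain ⟨B', hB'⟩ := exists_isCompl I
  -- `B` is a complement of `I` in `D`. Its dimension is `c`, and by maximality of `I` no nonzero
  -- vector of it is orthogonal to `I`.
  set B := B' ⊓ D with hBdef
  have hsup : I ⊔ B = D := by
    rw [hBdef, ← sup_inf_assoc_of_le _ hID, hB'.sup_eq_top, top_inf_eq]
  have hinf : I ⊓ B = ⊥ := by
    rw [hBdef, ← inf_assoc, hB'.inf_eq_bot, bot_inf_eq]
  have hfinB : Module.finrank L B = c := by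
    have := Submodule.finrank_sup_add_finrank_inf_eq I B
    rw [hsup, hinf, finrank_bot] at this
    omega
  have hBI : ∀ f ∈ B, f ≠ 0 → f ∉ ω.orthogonal I := by
    intro f hf hf0 hfI
    have : f ∈ I ⊓ B := ⟨hI ⟨hf.2, hfI⟩, hf⟩
    rw [hinf] at this
    exact hf0 ((Submodule.mem_bot L).1 this)
  set P := stabilizerProj ε χ I with hP
  have hPH : Pᴴ = P := stabilizerProj_conjTranspose ε
  have hPP : P * P = P := stabilizerProj_mul_self ε hII
  have htr : P.trace = Fintype.card (Fin k → A) := by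
    have hn : n = Module.finrank L I + k := by omega
    rw [hP, trace_stabilizerProj ε hχ1 h2, Fintype.card_fun, Fintype.card_fin, hA,
      Nat.cast_pow, inv_mul_eq_iff_eq_mul₀ (pow_ne_zero _ hq), ← pow_add, ← hn]
  obtain ⟨J, hJJ, hJJ'⟩ := exists_isometry_of_isHermitian_of_isIdempotentElem hPH hPP htr
  have hPJ : P * J = J := by rw [← hJJ', Matrix.mul_assoc, hJJ, Matrix.mul_one]
  have hJP : Jᴴ * P = Jᴴ := by rw [← hJJ', ← Matrix.mul_assoc, hJJ, Matrix.one_mul]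
  have hkill : ∀ f, f ∉ ω.orthogonal I → Jᴴ * weyl ε χ f * J = 0 := by
    intro f hf
    calc Jᴴ * weyl ε χ f * J = Jᴴ * (P * weyl ε χ f * P) * J := by
          conv_lhs => rw [← hJP, ← hPJ]
          simp only [Matrix.mul_assoc]
          rw [hPJ]
      _ = 0 := by
          rw [hP, stabilizerProj_mul_weyl_mul_stabilizerProj ε hχ1 h2 hII hf, Matrix.mul_zero,
            Matrix.zero_mul]
  let β : (Fin c → A) ≃ B := Fintype.equivOfCardEq (by
    rw [Module.card_eq_pow_finrank (K := L) (V := B), hfinB, Fintype.card_fun, Fintype.card_fin,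
      hA])
  -- The basis state `b` of the pairs selects a translate of the stabilizer code by an element of
  -- `B`. Distinct translates are orthogonal, which is why `V` is an isometry.
  let V : Matrix (Fin n → A) ((Fin k → A) × (Fin c → A)) ℂ :=
    Matrix.of fun x p => (weyl ε χ (β p.2 : Fin n → L × L) * J) x p.1
  have hV : Vᴴ * V = 1 := by
    ext ⟨u, b⟩ ⟨u', b'⟩
    have h1 : (Vᴴ * V) (u, b) (u', b') =
        ((weyl ε χ (β b : Fin n → L × L) * J)ᴴ * (weyl ε χ (β b' : Fin n → L × L) * J)) u u' := by
      simp only [Matrix.mul_apply, Matrix.conjTranspose_apply, V, Matrix.of_apply]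
    rw [h1, Matrix.conjTranspose_mul, weyl_conjTranspose]
    by_cases hb : b = b'
    · subst hb
      rw [Matrix.mul_assoc, ← Matrix.mul_assoc (weyl ε χ _), weyl_neg_mul_self, Matrix.one_mul,
        hJJ, Matrix.one_apply, Matrix.one_apply]
      simp
    · have hne : (-(β b) + β b' : Fin n → L × L) ≠ 0 := by
        intro h
        apply hb
        apply β.injective
        exact Subtype.ext (neg_add_eq_zero.1 h)
      have hmem : (-(β b) + β b' : Fin n → L × L) ∈ B :=
        B.add_mem (B.neg_mem (β b).2) (β b').2
      rw [Matrix.mul_assoc, ← Matrix.mul_assoc (weyl ε χ _), weyl_mul, Matrix.smul_mul,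
        Matrix.mul_smul, ← Matrix.mul_assoc, hkill _ (hBI _ hmem hne), smul_zero, Matrix.one_apply,
        if_neg]
      · rfl
      · simp [hb]
  let Q : EAQECC A n k c := ⟨V, hV⟩
  have hblock : ∀ b, Q.block b = weyl ε χ (β b : Fin n → L × L) * J := fun b => rfl
  have hconj : ∀ e, ∑ b, (Q.block b)ᴴ * weyl ε χ e * Q.block b =
      (∑ f : B, χ (2 * ω e f)) • (Jᴴ * weyl ε χ e * J) := by
    intro e
    rw [← Equiv.sum_comp β fun f : B => χ (2 * ω e f), Finset.sum_smul]
    refine Finset.sum_congr rfl fun b _ => ?_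
    rw [hblock, Matrix.conjTranspose_mul, weyl_conjTranspose]
    calc Jᴴ * weyl ε χ (-(β b : Fin n → L × L)) * weyl ε χ e *
          (weyl ε χ (β b : Fin n → L × L) * J)
        = Jᴴ * (weyl ε χ (-(β b : Fin n → L × L)) * weyl ε χ e *
            weyl ε χ (β b : Fin n → L × L)) * J := by simp only [Matrix.mul_assoc]
      _ = _ := by rw [weyl_neg_mul_mul, Matrix.mul_smul, Matrix.smul_mul]
  have hdet : ∀ e, e ∉ ω.orthogonal D → Q.Detects (weyl ε χ e) := by
    intro e he
    refine (Q.detects_iff _).2 ⟨0, ?_⟩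
    rw [hconj, zero_smul]
    by_cases heI : e ∈ ω.orthogonal I
    · have hB : ∃ f ∈ B, ω e f ≠ 0 := by
        by_contra! hB
        apply he
        intro x hx
        rw [← hsup] at hx
        obtain ⟨y, hy, z, hz, rfl⟩ := Submodule.mem_sup.1 hx
        have h1 : ω y e = 0 := heI y hy
        have h2 : ω z e = 0 := by rw [hω, symplecticForm_swap, ← hω, hB z hz, neg_zero]
        change ω (y + z) e = 0
        rw [map_add, LinearMap.add_apply, h1, h2, add_zero]
      obtain ⟨f, hf, hef⟩ := hB
      obtain ⟨a, ha⟩ := exists_addChar_two_mul_ne_one hχ1 h2 hef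
      -- An error orthogonal to `I` but not to `D` gives a nontrivial character of `B`, and the sum
      -- over the translates vanishes.
      let ψ : AddChar B ℂ := χ.compAddMonoidHom
        (((2 : L) • (ω e).domRestrict B).toAddMonoidHom)
      have hψ : ψ ≠ 0 := by
        refine AddChar.ne_one_iff.2 ⟨⟨a • f, B.smul_mem a hf⟩, ?_⟩
        simpa [ψ] using ha
      have hsum : ∑ f : B, χ (2 * ω e f) = 0 := AddChar.sum_eq_zero_iff_ne_zero.2 hψ
      rw [hsum, zero_smul]
    · rw [hkill e heI, smul_zero]
  refine ⟨Q, fun S E hS hE => ?_, ?_⟩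
  · refine EAQECC.Detects.of_mem_span ?_ (mem_span_weyl ε hχ h2 hE)
    rintro _ ⟨e, he, rfl⟩
    by_cases heD : e ∈ ω.orthogonal D
    · have he0 : e = 0 := by
        by_contra he0
        have h1 := hd e heD he0
        have h3 : hammingNorm e ≤ S.card := by
          refine Finset.card_le_card fun i hi => ?_
          by_contra hiS
          exact (Finset.mem_filter.1 hi).2 (he i hiS)
        omega
      rw [he0, weyl_zero]
      refine (Q.detects_iff _).2 ⟨(Fintype.card A : ℂ) ^ c, ?_⟩
      simp only [Matrix.mul_one]
      exact Q.sum_block_conjTranspose_mul_block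
    · exact hdet e heD
  · obtain ⟨e, heD, heD', hwt⟩ := hd'
    refine ⟨Finset.univ.filter fun i => e i ≠ 0, weyl ε χ e, hwt, actsOn_weyl ε (by simp), ?_⟩
    -- Detection would make the operator of `e` act as a scalar on the stabilizer code. Its trace
    -- there is zero because `e ∉ I`, so the scalar is zero, contradicting invertibility.
    intro hdetect
    obtain ⟨z, hz⟩ := (Q.detects_iff _).1 hdetect
    have hsum : ∑ f : B, χ (2 * ω e f) = Fintype.card B := by
      have : ∀ f : B, χ (2 * ω e f) = 1 := by
        intro f
        have h1 : ω f e = 0 := heD f f.2.2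
        rw [hω, symplecticForm_swap, ← hω, h1, neg_zero, mul_zero, AddChar.map_zero_eq_one]
      simp [this]
    have hN : (Fintype.card B : ℂ) ≠ 0 := Nat.cast_ne_zero.2 Fintype.card_ne_zero
    rw [hconj, hsum] at hz
    have hz' : Jᴴ * weyl ε χ e * J = ((Fintype.card B : ℂ)⁻¹ * z) • 1 := by
      rw [mul_smul, ← hz, smul_smul, inv_mul_cancel₀ hN, one_smul]
    have hcomm : weyl ε χ e * P = P * weyl ε χ e :=
      weyl_mul_stabilizerProj_comm ε (LinearMap.BilinForm.orthogonal_le hID heD)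
    have hWP : weyl ε χ e * P = ((Fintype.card B : ℂ)⁻¹ * z) • P := by
      calc weyl ε χ e * P = P * weyl ε χ e * P := by rw [← hcomm, Matrix.mul_assoc, hPP]
        _ = J * (Jᴴ * weyl ε χ e * J) * Jᴴ := by
          rw [← hJJ']
          simp only [Matrix.mul_assoc]
        _ = _ := by rw [hz', Matrix.mul_smul, Matrix.smul_mul, Matrix.mul_one, hJJ']
    have htr0 : P.trace ≠ 0 := by
      rw [htr]
      exact Nat.cast_ne_zero.2 Fintype.card_ne_zero
    have h0 := congrArg Matrix.trace hWP
    rw [hP, trace_weyl_mul_stabilizerProj ε hχ1 h2 fun h => heD' (hID h), ← hP,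
      Matrix.trace_smul, smul_eq_mul, eq_comm, mul_eq_zero, or_iff_left htr0] at h0
    rw [h0, zero_smul] at hWP
    apply htr0
    rw [← Matrix.one_mul P, ← weyl_neg_mul_self ε χ e, Matrix.mul_assoc, hWP, Matrix.mul_zero,
      Matrix.trace_zero]

/-! ### Conjugation on a field with `q²` elements -/

section Conjugation

set_option linter.unusedSectionVars false

variable {F : Type*} [Field F] [Fintype F] {q : ℕ}

/-- In an extension of a field with `q²` elements, `x ↦ x ^ q` is a ring homomorphism. -/
theorem exists_ringHom_eq_pow (hF : Fintype.card F = q ^ 2) (K : Type*) [Field K] [Algebra F K] :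
    ∃ φ : K →+* K, ∀ x, φ x = x ^ q := by
  obtain ⟨p, hp⟩ := CharP.exists F
  obtain ⟨m, hpp, hm⟩ := FiniteField.card F p
  have : Fact p.Prime := ⟨hpp⟩
  -- Since `q` divides `q² = p ^ m`, it is a power of the characteristic, and `x ↦ x ^ q` is an
  -- iterated Frobenius.
  obtain ⟨j, -, rfl⟩ := (Nat.dvd_prime_pow hpp).1
    (show q ∣ p ^ (m : ℕ) by rw [← hm, hF]; exact dvd_pow_self q two_ne_zero)
  have : CharP K p := charP_of_injective_algebraMap (algebraMap F K).injective p
  exact ⟨iterateFrobenius K p j, fun x => iterateFrobenius_def p j x⟩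

theorem pow_pow_self_of_card (hF : Fintype.card F = q ^ 2) (x : F) : (x ^ q) ^ q = x := by
  rw [← pow_mul, ← sq, ← hF, FiniteField.pow_card]

/-- A generator of the multiplicative group has order `q² - 1 > q - 1`. -/
theorem exists_pow_ne_self_of_card (hF : Fintype.card F = q ^ 2) (hq : 1 < q) :
    ∃ x : F, x ^ q ≠ x := by
  classical
  obtain ⟨g, hg⟩ := IsCyclic.exists_ofOrder_eq_natCard (α := Fˣ)
  refine ⟨g, fun h => ?_⟩
  have h1 : g ^ (q - 1) = 1 := by
    have : g ^ q = g := Units.ext (by simpa using h)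
    rw [show q = q - 1 + 1 by omega, pow_succ] at this
    exact mul_eq_right.1 this
  have h2 := Nat.le_of_dvd (by omega) (orderOf_dvd_of_pow_eq_one h1)
  rw [hg, Nat.card_eq_fintype_card, Fintype.card_units, hF] at h2
  have : q * 2 ≤ q ^ 2 := by nlinarith
  omega

/-- The coordinates of a field with `q²` elements over the fixed field of conjugation, with respect
to the basis `1, β`. -/
noncomputable def conjCoordinates {φ : F →+* F} (hφ : ∀ x, φ (φ x) = x) {β : F} (hβ : φ β ≠ β) :
    (φ.eqLocusField (RingHom.id F) × φ.eqLocusField (RingHom.id F)) ≃ₗ[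
      φ.eqLocusField (RingHom.id F)] F where
  toFun u := u.1 + u.2 * β
  map_add' u v := by
    simp only [Prod.fst_add, Prod.snd_add, Subfield.coe_add]
    ring
  map_smul' a u := by
    simp only [Prod.smul_fst, Prod.smul_snd, smul_eq_mul, Subfield.coe_mul, RingHom.id_apply,
      Subfield.smul_def]
    ring
  invFun x := (⟨x - (x - φ x) / (β - φ β) * β, by
      have h : β - φ β ≠ 0 := sub_ne_zero.2 hβ.symm
      have h' : φ β - β ≠ 0 := sub_ne_zero.2 hβ
      change φ _ = _
      simp only [map_sub, map_mul, map_div₀, hφ, RingHom.id_apply]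
      field_simp
      ring⟩, ⟨(x - φ x) / (β - φ β), by
      have h : β - φ β ≠ 0 := sub_ne_zero.2 hβ.symm
      have h' : φ β - β ≠ 0 := sub_ne_zero.2 hβ
      change φ _ = _
      simp only [map_sub, map_div₀, hφ, RingHom.id_apply]
      field_simp
      ring⟩)
  left_inv u := by
    have h : β - φ β ≠ 0 := sub_ne_zero.2 hβ.symm
    have h1 : φ u.1 = u.1 := u.1.2
    have h2 : φ u.2 = u.2 := u.2.2
    ext
    · simp only [map_add, map_mul, h1, h2]
      field_simp
      ring
    · simp only [map_add, map_mul, h1, h2]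
      field_simp
      ring
  right_inv x := by simp

theorem conjCoordinates_apply {φ : F →+* F} (hφ : ∀ x, φ (φ x) = x) {β : F} (hβ : φ β ≠ β)
    (u : φ.eqLocusField (RingHom.id F) × φ.eqLocusField (RingHom.id F)) :
    conjCoordinates hφ hβ u = u.1 + u.2 * β := rfl

end Conjugation

/-! ### Parity check matrices -/

section ParityCheck

variable {F : Type*} [Field F] {m n : ℕ} {C : Submodule F (Fin n → F)}

theorem IsParityCheck.exists_mul_eq_one {H : Matrix (Fin m) (Fin n) F} (hH : IsParityCheck C H) :
    ∃ R : Matrix (Fin n) (Fin m) F, H * R = 1 := by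
  rw [← Matrix.mulVec_surjective_iff_exists_right_inverse]
  have hker : LinearMap.ker H.mulVecLin = C := by
    ext v
    rw [LinearMap.mem_ker, Matrix.mulVecLin_apply, hH.2 v]
  have h := LinearMap.finrank_range_add_finrank_ker H.mulVecLin
  have h' := hH.1
  rw [hker, Module.finrank_fin_fun] at h
  have htop : LinearMap.range H.mulVecLin = ⊤ :=
    Submodule.eq_top_of_finrank_eq (by rw [Module.finrank_fin_fun]; omega)
  exact LinearMap.range_eq_top.1 htop

theorem exists_isParityCheck (h : Module.finrank F C + m = n) :
    ∃ H : Matrix (Fin m) (Fin n) F, IsParityCheck C H := by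
  have hq := Submodule.finrank_quotient_add_finrank C
  rw [Module.finrank_fin_fun] at hq
  let e : ((Fin n → F) ⧸ C) ≃ₗ[F] (Fin m → F) :=
    LinearEquiv.ofFinrankEq _ _ (by rw [Module.finrank_fin_fun]; omega)
  refine ⟨LinearMap.toMatrix' (e.toLinearMap ∘ₗ C.mkQ), h, fun v => ?_⟩
  rw [LinearMap.toMatrix'_mulVec]
  simp

end ParityCheck

/-! ### The Hermitian construction -/

/-- A code over a field with `q²` elements, `q` odd, with parity check matrix `H` gives an
entanglement-assisted code that uses `rank (H H*)` pairs. -/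
theorem exists_eaqecc_of_isParityCheck {F : Type*} [Field F] [Fintype F] [DecidableEq F] {q : ℕ}
    (hF : Fintype.card F = q ^ 2) (hq : 1 < q) (h2 : (2 : F) ≠ 0) {n m k d : ℕ}
    {C : Submodule F (Fin n → F)} {H : Matrix (Fin m) (Fin n) F} (hH : IsParityCheck C H)
    (hk : 2 * m + k = n + (H * hermTranspose q H).rank) (hd : ∀ c ∈ C, c ≠ 0 → d ≤ hammingNorm c)
    (hd' : ∃ c ∈ C, hammingNorm c = d ∧ ∃ c' ∈ C, ∑ i, c' i * c i ^ q ≠ 0) :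
    ∃ Q : EAQECC (Fin q) n k (H * hermTranspose q H).rank, Q.HasMinDist d := by
  classical
  obtain ⟨φ, hφq⟩ := exists_ringHom_eq_pow hF F
  have hφ : ∀ x, φ (φ x) = x := fun x => by rw [hφq, hφq, pow_pow_self_of_card hF]
  obtain ⟨β, hβ⟩ := exists_pow_ne_self_of_card hF hq
  rw [← hφq] at hβ
  set L := φ.eqLocusField (RingHom.id F)
  let τ : (L × L) ≃ₗ[L] F := conjCoordinates hφ hβ
  have hτ : ∀ u, τ u = u.1 + u.2 * β := conjCoordinates_apply hφ hβ
  have hcardL : Fintype.card L = q := by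
    have h := Fintype.card_congr τ.toEquiv
    rw [Fintype.card_prod, hF, ← sq] at h
    exact Nat.pow_left_injective two_ne_zero h
  have hfin : Module.finrank L F = 2 := by
    rw [← τ.finrank_eq, Module.finrank_prod, Module.finrank_self]
  have h2L : (2 : L) ≠ 0 := fun h => h2 (congrArg L.subtype h)
  let ε : Fin q ≃ L := Fintype.equivOfCardEq (by rw [Fintype.card_fin, hcardL])
  let T : (Fin n → L × L) ≃ₗ[L] (Fin n → F) := LinearEquiv.piCongrRight fun _ => τ
  have hT : ∀ e i, T e i = τ (e i) := fun e i => rfl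
  have hnorm : ∀ e, hammingNorm (T e) = hammingNorm e := fun e =>
    hammingNorm_comp (fun _ => τ) (fun _ => τ.injective) (fun _ => map_zero τ)
  set G := hermTranspose q H with hG
  have hGij : ∀ i j, G i j = φ (H j i) := fun i j => (hφq _).symm
  obtain ⟨R, hR⟩ := hH.exists_mul_eq_one
  have hGinj : Function.Injective G.mulVecLin := by
    have hl : (R.map φ)ᵀ * G = 1 := by
      have : G = (H.map φ)ᵀ := by
        ext i j
        rw [hGij]
        rfl
      rw [this, ← Matrix.transpose_mul, ← Matrix.map_mul, hR, Matrix.map_one _ (map_zero φ)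
        (map_one φ), Matrix.transpose_one]
    intro v w hvw
    have := congrArg (fun x => (R.map φ)ᵀ *ᵥ x) hvw
    simpa [Matrix.mulVec_mulVec, hl] using this
  -- `D'` is the Hermitian dual of `C`; `D` below is the same space in coordinates over `L`.
  let D' : Submodule F (Fin n → F) := LinearMap.range G.mulVecLin
  have hherm : ∀ (c x : Fin n → F), c ∈ C → x ∈ D' → ∑ i, c i * φ (x i) = 0 := by
    rintro c _ hc ⟨y, rfl⟩
    have h0 : H *ᵥ c = 0 := (hH.2 c).1 hc
    have : ∑ i, c i * φ ((G *ᵥ y) i) = ∑ j, φ (y j) * (H *ᵥ c) j := by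
      simp only [Matrix.mulVec, dotProduct, map_sum, map_mul, hGij, hφ, Finset.mul_sum]
      rw [Finset.sum_comm]
      exact Finset.sum_congr rfl fun j _ => Finset.sum_congr rfl fun i _ => by ring
    rw [Matrix.mulVecLin_apply, this, h0]
    simp
  -- The symplectic form is, up to the factor `β - φ β`, the skew part of the Hermitian form.
  have hform : ∀ e f : Fin n → L × L, (β - φ β) * (symplecticForm L n e f : F) =
      ∑ i, T e i * φ (T f i) - φ (∑ i, T e i * φ (T f i)) := by
    intro e f
    rw [symplecticForm_apply, map_sum, ← Finset.sum_sub_distrib, AddSubmonoidClass.coe_finsetSum,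
      Finset.mul_sum]
    refine Finset.sum_congr rfl fun i _ => ?_
    have h1 : φ (e i).1 = (e i).1 := (e i).1.2
    have h2 : φ (e i).2 = (e i).2 := (e i).2.2
    have h3 : φ (f i).1 = (f i).1 := (f i).1.2
    have h4 : φ (f i).2 = (f i).2 := (f i).2.2
    simp only [hT, hτ, map_add, map_mul, hφ, h1, h2, h3, h4, Subfield.coe_sub, Subfield.coe_mul]
    ring
  have hββ : β - φ β ≠ 0 := sub_ne_zero.2 hβ.symm
  let D : Submodule L (Fin n → L × L) := (D'.restrictScalars L).comap T.toLinearMap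
  have hDmem : ∀ e, e ∈ D ↔ T e ∈ D' := fun e => Iff.rfl
  have hDO : ∀ e, e ∈ (symplecticForm L n).orthogonal D ↔ T e ∈ C := by
    intro e
    constructor
    · intro he
      have hzero : ∀ x ∈ D', ∑ i, T e i * φ (x i) = 0 := by
        intro x hx
        by_contra ht
        -- `D'` is stable under scalars from `F`, so every multiple of the Hermitian product is
        -- fixed by `φ`. The product and its multiple by `β` are both fixed only if the product is
        -- zero.
        have hfix : ∀ μ : F, φ (φ μ * ∑ i, T e i * φ (x i)) = φ μ * ∑ i, T e i * φ (x i) := by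
          intro μ
          have h1 : symplecticForm L n (T.symm (μ • x)) e = 0 :=
            he _ (by rw [hDmem, LinearEquiv.apply_symm_apply]; exact D'.smul_mem μ hx)
          have h2 := hform e (T.symm (μ • x))
          rw [symplecticForm_swap, h1, neg_zero, ZeroMemClass.coe_zero, mul_zero, eq_comm,
            sub_eq_zero, LinearEquiv.apply_symm_apply] at h2
          have h3 : ∑ i, T e i * φ ((μ • x) i) = φ μ * ∑ i, T e i * φ (x i) := by
            rw [Finset.mul_sum]
            exact Finset.sum_congr rfl fun i _ => by
              rw [Pi.smul_apply, smul_eq_mul, map_mul]; ring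
          rw [← h3, ← h2]
        have h1 := hfix 1
        have h2 := hfix (φ β)
        rw [map_one, one_mul] at h1
        rw [hφ, map_mul, h1] at h2
        exact hβ (mul_right_cancel₀ ht h2)
      rw [hH.2]
      funext j
      have := hzero (G *ᵥ Pi.single j 1) ⟨_, rfl⟩
      simp only [Matrix.mulVec_single_one, Matrix.col_apply, hGij, hφ] at this
      rw [Pi.zero_apply, ← this, Matrix.mulVec, dotProduct]
      exact Finset.sum_congr rfl fun i _ => mul_comm (H j i) (T e i)
    · intro he f hf
      change symplecticForm L n f e = 0
      have h := hform e f
      rw [hherm _ _ he ((hDmem f).1 hf), map_zero, sub_zero, mul_eq_zero, or_iff_right hββ] at h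
      have h' : symplecticForm L n e f = 0 := Subtype.ext h
      rw [symplecticForm_swap, h', neg_zero]
  have hfinD : ∀ W : Submodule F (Fin n → F),
      Module.finrank L ((W.restrictScalars L).comap T.toLinearMap) = 2 * Module.finrank F W := by
    intro W
    rw [← hfin, Module.finrank_mul_finrank L F W]
    have h := LinearEquiv.finrank_map_eq T ((W.restrictScalars L).comap T.toLinearMap)
    rw [Submodule.map_comap_eq_of_surjective T.surjective] at h
    exact h.symm
  have hD'fin : Module.finrank F D' = m := by
    rw [LinearMap.finrank_range_of_inj hGinj, Module.finrank_fin_fun]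
  have hhull : Module.finrank F (D' ⊓ C : Submodule F _) + (H * G).rank = m := by
    -- `G y` lies in `C` exactly when `H G y = 0`, so rank-nullity for `H G` gives the dimension of
    -- the radical.
    have hmap : D' ⊓ C = (LinearMap.ker (H * G).mulVecLin).map G.mulVecLin := by
      ext x
      constructor
      · rintro ⟨⟨y, rfl⟩, hx⟩
        refine ⟨y, ?_, rfl⟩
        rw [SetLike.mem_coe, LinearMap.mem_ker, Matrix.mulVecLin_apply, ← Matrix.mulVec_mulVec]
        exact (hH.2 _).1 hx
      · rintro ⟨y, hy, rfl⟩
        refine ⟨⟨y, rfl⟩, (hH.2 _).2 ?_⟩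
        rw [Matrix.mulVecLin_apply, Matrix.mulVec_mulVec]
        exact hy
    have h := LinearMap.finrank_range_add_finrank_ker (H * G).mulVecLin
    rw [Module.finrank_fin_fun] at h
    rw [hmap, (Submodule.equivMapOfInjective _ hGinj _).finrank_eq.symm, Matrix.rank,
      add_comm, h]
  refine exists_eaqecc_hasMinDist ε h2L D ?_ ?_ ?_ ?_
  · rw [hfinD, hD'fin, hk]
  · have hinf : D ⊓ (symplecticForm L n).orthogonal D =
        ((D' ⊓ C).restrictScalars L).comap T.toLinearMap := by
      ext e
      rw [Submodule.mem_inf, hDO, hDmem]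
      rfl
    rw [hinf, hfinD, hfinD, hD'fin]
    omega
  · intro e he he0
    rw [← hnorm]
    exact hd _ ((hDO e).1 he) (by simpa using he0)
  · obtain ⟨c, hc, hwt, c', hc', hne⟩ := hd'
    refine ⟨T.symm c, (hDO _).2 (by simpa using hc), fun h => hne ?_, ?_⟩
    · have := hherm c' c hc' (by simpa using (hDmem _).1 h)
      simpa only [hφq] using this
    · rw [← hnorm, LinearEquiv.apply_symm_apply, hwt]

/-! ### The defining set -/

section DefiningSet

/-- The points of sup norm less than `a + b` of the square lattice generated by `(a, b)` and
`(-b, a)`. -/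
theorem lattice_point_cases {a b x y : ℤ} (ha : 0 < a) (hb : 0 < b)
    (h₁ : |x * a - y * b| < a + b) (h₂ : |x * b + y * a| < a + b) :
    (x = 0 ∧ y = 0) ∨ (x = 1 ∧ y = 0) ∨ (x = -1 ∧ y = 0) ∨ (x = 0 ∧ y = 1) ∨ (x = 0 ∧ y = -1) := by
  have h₁' := sq_lt_sq' (abs_lt.1 h₁).1 (abs_lt.1 h₁).2
  have h₂' := sq_lt_sq' (abs_lt.1 h₂).1 (abs_lt.1 h₂).2
  have hab : 0 < a ^ 2 + b ^ 2 := by positivity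
  -- The squared length is `(x² + y²)(a² + b²)` and is below `2 (a + b)² ≤ 4 (a² + b²)`. The
  -- remaining diagonal points have sup norm exactly `a + b`.
  have hlt : x ^ 2 + y ^ 2 < 4 := by
    have : (x ^ 2 + y ^ 2) * (a ^ 2 + b ^ 2) < 4 * (a ^ 2 + b ^ 2) := by
      nlinarith [sq_nonneg (a - b)]
    exact lt_of_mul_lt_mul_right this hab.le
  have hx1 : -1 ≤ x := by nlinarith [sq_nonneg y]
  have hx2 : x ≤ 1 := by nlinarith [sq_nonneg y]
  have hy1 : -1 ≤ y := by nlinarith [sq_nonneg x]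
  have hy2 : y ≤ 1 := by nlinarith [sq_nonneg x]
  rw [abs_lt] at h₁ h₂
  obtain ⟨h₁, h₁''⟩ := h₁
  obtain ⟨h₂, h₂''⟩ := h₂
  interval_cases x <;> interval_cases y <;> omega

/-- The solutions of `t + q t' ≡ 0` modulo `(q² + 1) / 10`, for `q = 10 u + 7`, with small `t`
and `t'`. -/
theorem small_solution_cases {u : ℤ} (hu : 0 ≤ u) {t t' : ℤ} (ht : |t| ≤ 4 * u + 2)
    (ht' : |t'| ≤ 4 * u + 2) (h : 10 * u ^ 2 + 14 * u + 5 ∣ t + (10 * u + 7) * t') :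
    t = 0 ∨ t = 3 * u + 2 ∨ t = -(3 * u + 2) ∨ t = u + 1 ∨ t = -(u + 1) := by
  obtain ⟨w, hw⟩ := h
  -- These are the coordinates of `t' - i t` divided by `a + i b` in the Gaussian integers,
  -- simplified with `a + q b = 3n` and `q a - b = n`.
  have key := lattice_point_cases (a := u + 1) (b := 3 * u + 2) (x := 3 * t' - (3 * u + 2) * w)
    (y := t' - (u + 1) * w) (by omega) (by omega)
    (by
      rw [show (3 * t' - (3 * u + 2) * w) * (u + 1) - (t' - (u + 1) * w) * (3 * u + 2) = t' by ring]
      omega)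
    (by
      rw [show (3 * t' - (3 * u + 2) * w) * (3 * u + 2) + (t' - (u + 1) * w) * (u + 1) = -t by
        linear_combination hw, abs_neg]
      omega)
  have ht : t = -((3 * t' - (3 * u + 2) * w) * (3 * u + 2) + (t' - (u + 1) * w) * (u + 1)) := by
    linear_combination hw
  rcases key with ⟨h1, h2⟩ | ⟨h1, h2⟩ | ⟨h1, h2⟩ | ⟨h1, h2⟩ | ⟨h1, h2⟩ <;>
    rw [h1, h2] at ht <;> omega

variable {q n r s : ℕ}

/-- The exponent `s + r t` modulo `r n`. -/
def exponent (r n s : ℕ) (t : ℤ) : ZMod (r * n) :=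
  (s : ZMod (r * n)) + (r : ZMod (r * n)) * (t : ZMod (r * n))

theorem exponent_eq_exponent_iff (hr : r ≠ 0) {t t' : ℤ} :
    exponent r n s t = exponent r n s t' ↔ (n : ℤ) ∣ t - t' := by
  rw [exponent, exponent, add_right_inj]
  have h : ∀ a : ℤ, (r : ZMod (r * n)) * (a : ZMod (r * n)) = ((r * a : ℤ) : ZMod (r * n)) := by
    intro a
    push_cast
    rfl
  rw [h, h, ← sub_eq_zero, ← Int.cast_sub, ZMod.intCast_zmod_eq_zero_iff_dvd, ← mul_sub,
    Nat.cast_mul]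
  exact mul_dvd_mul_iff_left (by exact_mod_cast hr)

theorem natCast_mul_natCast_zmod (r n : ℕ) : (r : ZMod (r * n)) * (n : ZMod (r * n)) = 0 := by
  rw [← Nat.cast_mul, ZMod.natCast_self]

/-- Modulo `r n`, `r q² = r (10n - 1) ≡ -r`, while `s (q² - 1) = 5 n r (q - 1) ≡ 0`. -/
theorem exponent_mul_sq (hn : 10 * n = q ^ 2 + 1) (hr : r = q + 1) (hs : s = 5 * n) (t : ℤ) :
    exponent r n s t * (q : ZMod (r * n)) ^ 2 = exponent r n s (-t) := by
  have h0 := natCast_mul_natCast_zmod r n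
  have h1 : (10 : ZMod (r * n)) * n = q ^ 2 + 1 := by exact_mod_cast congrArg Nat.cast hn
  have h2 : (r : ZMod (r * n)) = q + 1 := by exact_mod_cast congrArg Nat.cast hr
  have h3 : (s : ZMod (r * n)) = 5 * n := by exact_mod_cast congrArg Nat.cast hs
  rw [exponent, exponent, h3, Int.cast_neg]
  linear_combination (-(t : ZMod (r * n)) * r) * h1 + (10 * (t : ZMod (r * n)) + 5 * (q - 1)) * h0 -
    5 * n * (q - 1) * h2

/-- The centre `s` is fixed by `-q`, since `s (q + 1) = 5 r n`. -/
theorem neg_mul_exponent (hr : r = q + 1) (hs : s = 5 * n) (t : ℤ) :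
    -((q : ZMod (r * n)) * exponent r n s t) = exponent r n s (-(q * t)) := by
  have h0 := natCast_mul_natCast_zmod r n
  have h2 : (r : ZMod (r * n)) = q + 1 := by exact_mod_cast congrArg Nat.cast hr
  have h3 : (s : ZMod (r * n)) = 5 * n := by exact_mod_cast congrArg Nat.cast hs
  rw [exponent, exponent, h3]
  push_cast
  linear_combination -5 * h0 + 5 * n * h2

theorem cyclotomicCoset_exponent (hn : 10 * n = q ^ 2 + 1) (hr : r = q + 1) (hs : s = 5 * n)
    (t : ℤ) :
    cyclotomicCoset q (r * n) (exponent r n s t) = {exponent r n s t, exponent r n s (-t)} := by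
  have h : ∀ j : ℕ, exponent r n s t * (q : ZMod (r * n)) ^ (2 * j) =
      exponent r n s ((-1) ^ j * t) := by
    intro j
    induction j with
    | zero => simp
    | succ j ih =>
      rw [Nat.mul_succ, pow_add, ← mul_assoc, ih, exponent_mul_sq hn hr hs]
      congr 1
      ring
  ext x
  constructor
  · rintro ⟨j, rfl⟩
    rw [h]
    rcases neg_one_pow_eq_or ℤ j with hj | hj <;> simp [hj]
  · rintro (rfl | rfl)
    · exact ⟨0, by simp⟩
    · exact ⟨1, by rw [h]; simp⟩

theorem iUnion_cyclotomicCoset (hn : 10 * n = q ^ 2 + 1) (hr : r = q + 1) (hs : s = 5 * n)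
    (T : ℕ) :
    (⋃ j ∈ Set.Iic T,
      cyclotomicCoset q (r * n) ((s : ZMod (r * n)) - (r : ZMod (r * n)) * (j : ZMod (r * n)))) =
    exponent r n s '' {t | |t| ≤ T} := by
  have h : ∀ j : ℕ, (s : ZMod (r * n)) - (r : ZMod (r * n)) * (j : ZMod (r * n)) =
      exponent r n s (-j) := by
    intro j
    rw [exponent]
    push_cast
    ring
  ext x
  simp only [Set.mem_iUnion, Set.mem_Iic, exists_prop, h, cyclotomicCoset_exponent hn hr hs,
    neg_neg, Set.mem_insert_iff, Set.mem_singleton_iff, Set.mem_image, Set.mem_ofPred_eq]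
  constructor
  · rintro ⟨j, hj, rfl | rfl⟩
    · exact ⟨-j, by rw [abs_neg, Nat.abs_cast]; exact_mod_cast hj, rfl⟩
    · exact ⟨j, by rw [Nat.abs_cast]; exact_mod_cast hj, rfl⟩
  · rintro ⟨t, ht, rfl⟩
    rw [abs_le] at ht
    refine ⟨t.natAbs, by omega, ?_⟩
    rcases Int.natAbs_eq t with h | h
    · right
      rw [← h]
    · left
      rw [← h]

/-- The intersection of `Z` with `-q Z`, for `q = 10 u + 7`. -/
theorem inter_negMulSet_exponent {u T : ℕ} (hq : q = 10 * u + 7)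
    (hn : n = 10 * u ^ 2 + 14 * u + 5) (hr : r = q + 1) (hs : s = 5 * n) (hT : 3 * u + 2 ≤ T)
    (hT' : T ≤ 4 * u + 2) :
    exponent r n s '' {t | |t| ≤ T} ∩ negMulSet q (exponent r n s '' {t | |t| ≤ T}) =
      exponent r n s '' {0, 3 * (u : ℤ) + 2, -(3 * (u : ℤ) + 2), (u : ℤ) + 1, -((u : ℤ) + 1)} := by
  have hr0 : r ≠ 0 := by omega
  have hnZ : (n : ℤ) = 10 * (u : ℤ) ^ 2 + 14 * u + 5 := by exact_mod_cast hn
  have hqZ : (q : ℤ) = 10 * (u : ℤ) + 7 := by exact_mod_cast hq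
  ext x
  constructor
  · rintro ⟨⟨t, ht, rfl⟩, ⟨_, ⟨t', ht', rfl⟩, h⟩⟩
    rw [Set.mem_ofPred_eq] at ht ht'
    simp only at h
    rw [neg_mul_exponent hr hs, eq_comm, exponent_eq_exponent_iff hr0, sub_neg_eq_add, hnZ,
      hqZ] at h
    refine ⟨t, ?_, rfl⟩
    simpa using small_solution_cases (u := u) (by omega) (by omega) (by omega) h
  · rintro ⟨t, ht, rfl⟩
    have hmem : ∀ t' : ℤ, |t'| ≤ T → (n : ℤ) ∣ t + q * t' →
        exponent r n s t ∈ negMulSet q (exponent r n s '' {t | |t| ≤ T}) := by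
      intro t' ht' hd
      refine ⟨_, ⟨t', ht', rfl⟩, ?_⟩
      simp only
      rw [neg_mul_exponent hr hs, eq_comm, exponent_eq_exponent_iff hr0, sub_neg_eq_add]
      exact hd
    simp only [Set.mem_insert_iff, Set.mem_singleton_iff] at ht
    refine ⟨⟨t, ?_, rfl⟩, ?_⟩
    · rw [Set.mem_ofPred_eq, abs_le]
      omega
    -- The partners `t'` come from `b - q a = -n` and `a + q b = 3n`, with `a = u + 1` and `b = 3u +
    -- 2`.
    · rcases ht with rfl | rfl | rfl | rfl | rfl
      · exact hmem 0 (by simp) (by simp)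
      · exact hmem (-(u + 1)) (abs_le.2 (by omega)) ⟨-1, by rw [hnZ, hqZ]; ring⟩
      · exact hmem (u + 1) (abs_le.2 (by omega)) ⟨1, by rw [hnZ, hqZ]; ring⟩
      · exact hmem (3 * u + 2) (abs_le.2 (by omega)) ⟨3, by rw [hnZ, hqZ]; ring⟩
      · exact hmem (-(3 * u + 2)) (abs_le.2 (by omega)) ⟨-3, by rw [hnZ, hqZ]; ring⟩

theorem ncard_exponent_image {u : ℕ} (hn : n = 10 * u ^ 2 + 14 * u + 5) (hr : r ≠ 0) :
    (exponent r n s ''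
      {0, 3 * (u : ℤ) + 2, -(3 * (u : ℤ) + 2), (u : ℤ) + 1, -((u : ℤ) + 1)}).ncard = 5 := by
  have hnZ : (n : ℤ) = 10 * (u : ℤ) ^ 2 + 14 * u + 5 := by exact_mod_cast hn
  rw [Set.InjOn.ncard_image]
  · have : ({0, 3 * (u : ℤ) + 2, -(3 * (u : ℤ) + 2), (u : ℤ) + 1, -((u : ℤ) + 1)} : Set ℤ) =
        (({0, 3 * (u : ℤ) + 2, -(3 * (u : ℤ) + 2), (u : ℤ) + 1, -((u : ℤ) + 1)} : Finset ℤ) :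
          Set ℤ) := by simp
    rw [this, Set.ncard_coe_finset]
    rw [Finset.card_insert_of_notMem, Finset.card_insert_of_notMem, Finset.card_insert_of_notMem,
      Finset.card_insert_of_notMem, Finset.card_singleton] <;>
    simp only [Finset.mem_insert, Finset.mem_singleton, not_or] <;> omega
  · intro t ht t' ht' h
    rw [exponent_eq_exponent_iff hr] at h
    have hlt : |t - t'| < n := by
      rw [abs_lt]
      simp only [Set.mem_insert_iff, Set.mem_singleton_iff] at ht ht'
      have : 6 * (u : ℤ) + 4 < n := by nlinarith
      omega
    exact sub_eq_zero.1 (Int.eq_zero_of_abs_lt_dvd h hlt)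

end DefiningSet

/-! ### Constacyclic codes with consecutive roots -/

section Code

open Polynomial

variable {F K : Type*} [Field F] [Field K] [Algebra F K] {n m r e₀ : ℕ} {α : F} {δ : K}
  {C : Submodule F (Fin n → F)}

theorem IsPrimitiveRoot.pow_val_natCast {N : ℕ} (hδ : IsPrimitiveRoot δ N) (k : ℕ) :
    δ ^ (k : ZMod N).val = δ ^ k := by
  rw [ZMod.val_natCast]
  conv_lhs => rw [hδ.eq_orderOf, pow_mod_orderOf]

theorem aeval_wordPoly (c : Fin n → F) (x : K) :
    aeval x (wordPoly c) = ∑ l, algebraMap F K (c l) * x ^ (l : ℕ) := by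
  simp [wordPoly, aeval_monomial]

/-- The exponents `e₀ + r i`, `i < m`, as a subset of `ZMod (r n)`. -/
def consecutiveSet (r n e₀ m : ℕ) : Set (ZMod (r * n)) :=
  {z | ∃ i < m, z = ((e₀ + r * i : ℕ) : ZMod (r * n))}

/-- The roots of the generator polynomial of a code with a defining set of consecutive exponents. -/
theorem exists_generator_of_hasDefiningSet (hr : r ≠ 0) (hn : n ≠ 0)
    (hδ : IsPrimitiveRoot δ (r * n)) (hδα : δ ^ n = algebraMap F K α) (hm : m ≤ n)
    (hC : HasDefiningSet r α δ C (consecutiveSet r n e₀ m)) :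
    ∃ g : F[X], IsGeneratorPoly α C g ∧ g.natDegree = m ∧
      ∀ i < m, aeval (δ ^ (e₀ + r * i)) g = 0 := by
  classical
  obtain ⟨g, hg, hZ⟩ := hC
  have hroot : ∀ i < m, aeval (δ ^ (e₀ + r * i)) g = 0 := by
    intro i hi
    have h : ((e₀ + r * i : ℕ) : ZMod (r * n)) ∈ consecutiveSet r n e₀ m := ⟨i, hi, rfl⟩
    rw [hZ] at h
    rw [← hδ.pow_val_natCast]
    exact h.2
  refine ⟨g, hg, ?_, hroot⟩
  have hδ0 : δ ≠ 0 := hδ.ne_zero (Nat.mul_ne_zero hr hn)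
  have hζ : IsPrimitiveRoot (δ ^ r) n := hδ.pow (Nat.pos_of_ne_zero (Nat.mul_ne_zero hr hn)) rfl
  have hdvd : g.map (algebraMap F K) ∣ X ^ n - Polynomial.C (δ ^ n) := by
    have := Polynomial.map_dvd (algebraMap F K) hg.2.1
    simpa [hδα] using this
  have hne : (X ^ n - Polynomial.C (δ ^ n) : K[X]) ≠ 0 := X_pow_sub_C_ne_zero (by omega) _
  have hsplit : (g.map (algebraMap F K)).Splits :=
    (X_pow_sub_C_splits_of_isPrimitiveRoot hζ rfl).of_dvd hne hdvd
  have hnodup : (g.map (algebraMap F K)).roots.Nodup :=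
    Multiset.nodup_of_le (roots.le_of_dvd hne hdvd) (hζ.nthRoots_nodup (pow_ne_zero n hδ0))
  have hg0 : g.map (algebraMap F K) ≠ 0 := (hg.1.map _).ne_zero
  -- The roots of `X ^ n - α` are simple and all of the form `δ ^ (1 + r j)`, so the degree of `g`
  -- is the number of its exponents.
  have hroots : (g.map (algebraMap F K)).roots.toFinset =
      (Finset.range m).image fun i => δ ^ (e₀ + r * i) := by
    ext x
    rw [Multiset.mem_toFinset, mem_roots hg0, IsRoot.def, eval_map_algebraMap, Finset.mem_image]
    constructor
    · intro hx
      have hxn : x ^ n = δ ^ n := by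
        have : (X ^ n - Polynomial.C (δ ^ n) : K[X]).eval x = 0 :=
          eval_eq_zero_of_dvd_of_eval_eq_zero hdvd (by rwa [eval_map_algebraMap])
        simpa [sub_eq_zero] using this
      have h1 : (x / δ) ^ n = 1 := by
        rw [div_pow, hxn, div_self (pow_ne_zero n hδ0)]
      have : NeZero n := ⟨hn⟩
      obtain ⟨j, hj, hjx⟩ := hζ.eq_pow_of_pow_eq_one h1
      have hx' : x = δ ^ (1 + r * j) := by
        rw [pow_add, pow_one, pow_mul, hjx, mul_div_cancel₀ _ hδ0]
      have hmem : ((1 + r * j : ℕ) : ZMod (r * n)) ∈ consecutiveSet r n e₀ m := by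
        rw [hZ]
        refine ⟨⟨j, hj, by push_cast; rfl⟩, ?_⟩
        rwa [hδ.pow_val_natCast, ← hx']
      obtain ⟨i, hi, hij⟩ := hmem
      refine ⟨i, Finset.mem_range.2 hi, ?_⟩
      rw [hx', ← hδ.pow_val_natCast, ← hij, hδ.pow_val_natCast]
    · rintro ⟨i, hi, rfl⟩
      exact hroot i (Finset.mem_range.1 hi)
  rw [← natDegree_map (algebraMap F K), hsplit.natDegree_eq_card_roots,
    ← Multiset.toFinset_card_of_nodup hnodup, hroots, Finset.card_image_of_injOn,
    Finset.card_range]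
  intro i hi j hj hij
  simp only [pow_add, pow_mul] at hij
  exact hζ.pow_inj (by have := Finset.mem_range.1 hi; omega)
    (by have := Finset.mem_range.1 hj; omega) (mul_left_cancel₀ (pow_ne_zero _ hδ0) hij)

/-- `C` is the kernel of the map from words to `F[X] / (g)`, which is onto because remainders modulo
`g` have degree below `n`. -/
theorem finrank_add_natDegree_of_isGeneratorPoly (hn : 0 < n) {g : F[X]}
    (hg : IsGeneratorPoly α C g) (hgn : g.natDegree ≤ n) :
    Module.finrank F C + g.natDegree = n := by
  let f : (Fin n → F) →ₗ[F] F[X] ⧸ Ideal.span {g} :=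
    (Ideal.Quotient.mkₐ F (Ideal.span {g})).toLinearMap ∘ₗ
      ∑ i : Fin n, monomial (i : ℕ) ∘ₗ LinearMap.proj i
  have hf : ∀ c, f c = Ideal.Quotient.mk (Ideal.span {g}) (wordPoly c) := by
    intro c
    simp [f, wordPoly]
  have hker : LinearMap.ker f = C := by
    ext c
    rw [LinearMap.mem_ker, hf, Ideal.Quotient.eq_zero_iff_mem, Ideal.mem_span_singleton, hg.2.2]
  have hsurj : Function.Surjective f := by
    intro y
    obtain ⟨p, rfl⟩ := Ideal.Quotient.mk_surjective y
    refine ⟨fun i => (p %ₘ g).coeff i, ?_⟩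
    have hlt : p %ₘ g ∈ degreeLT F n := by
      rw [mem_degreeLT]
      exact (degree_modByMonic_lt p hg.1).trans_le
        (degree_le_natDegree.trans (by exact_mod_cast hgn))
    have hw : wordPoly (fun i : Fin n => (p %ₘ g).coeff i) = p %ₘ g := by
      rw [wordPoly, Fin.sum_univ_eq_sum_range fun i => monomial i ((p %ₘ g).coeff i)]
      refine (as_sum_range' _ n ?_).symm
      rcases eq_or_ne (p %ₘ g) 0 with h0 | h0
      · rw [h0, natDegree_zero]
        exact hn
      · exact (natDegree_lt_iff_degree_lt h0).2 (mem_degreeLT.1 hlt)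
    rw [hf, hw, Ideal.Quotient.eq, Ideal.mem_span_singleton]
    refine ⟨-(p /ₘ g), ?_⟩
    linear_combination modByMonic_add_div p g
  have h := LinearMap.finrank_range_add_finrank_ker f
  rw [hker, LinearMap.range_eq_top.2 hsurj, finrank_top, finrank_quotient_span_eq_natDegree,
    Module.finrank_fin_fun] at h
  omega

/-- A word with `m` consecutive zeros and at most `m` nonzero coordinates vanishes. -/
theorem eq_zero_of_sum_pow_eq_zero {ι : Type*} [Fintype ι] [DecidableEq K] {y v : ι → K}
    (hv : Function.Injective v) (h : ∀ i < m, ∑ l, y l * v l ^ i = 0)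
    (hy : hammingNorm y ≤ m) : y = 0 := by
  classical
  by_contra h0
  obtain ⟨l₀, hl₀⟩ := Function.ne_iff.1 h0
  let S : Finset ι := Finset.univ.filter fun l => y l ≠ 0
  have hl₀S : l₀ ∈ S := by simpa [S] using hl₀
  have hS : S.card ≤ m := hy
  -- A polynomial of degree less than `m` vanishing on the support except at `l₀`: pairing it with
  -- `y` isolates `y l₀`.
  let p : K[X] := ∏ l ∈ S.erase l₀, (X - Polynomial.C (v l))
  have hp : p.natDegree < m := by
    rw [natDegree_prod_of_monic _ _ fun l _ => monic_X_sub_C _]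
    simp only [natDegree_X_sub_C, Finset.sum_const, smul_eq_mul, mul_one]
    rw [Finset.card_erase_of_mem hl₀S]
    have := Finset.card_pos.2 ⟨l₀, hl₀S⟩
    omega
  have hsum : ∑ l, y l * p.eval (v l) = 0 := by
    simp only [eval_eq_sum_range' hp, Finset.mul_sum]
    rw [Finset.sum_comm]
    refine Finset.sum_eq_zero fun i hi => ?_
    rw [← mul_zero (p.coeff i), ← h i (Finset.mem_range.1 hi), Finset.mul_sum]
    exact Finset.sum_congr rfl fun l _ => by ring
  rw [Finset.sum_eq_single l₀] at hsum
  · rcases mul_eq_zero.1 hsum with h1 | h1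
    · exact hl₀ h1
    · rw [eval_prod, Finset.prod_eq_zero_iff] at h1
      obtain ⟨l, hl, hl'⟩ := h1
      rw [eval_sub, eval_X, eval_C, sub_eq_zero] at hl'
      exact (Finset.mem_erase.1 hl).1 (hv hl').symm
  · intro l _ hl
    by_cases hlS : l ∈ S
    · rw [eval_prod, Finset.prod_eq_zero (Finset.mem_erase.2 ⟨hl, hlS⟩) (by simp), mul_zero]
    · rw [show y l = 0 by simpa [S] using hlS, zero_mul]
  · simp

/-- This is the BCH bound: absorbing `x ^ l` into the coefficients turns zeros in geometric
progression into power sums with distinct nodes `ζ ^ l`. -/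
theorem lt_hammingNorm_of_roots [DecidableEq F] {x ζ : K} (hx : x ≠ 0) (hζ : IsPrimitiveRoot ζ n)
    {c : Fin n → F} (h : ∀ i < m, ∑ l, algebraMap F K (c l) * (x * ζ ^ i) ^ (l : ℕ) = 0)
    (hc : c ≠ 0) : m < hammingNorm c := by
  classical
  by_contra! hle
  have hy := eq_zero_of_sum_pow_eq_zero (m := m)
    (y := fun l : Fin n => algebraMap F K (c l) * x ^ (l : ℕ))
    (v := fun l : Fin n => ζ ^ (l : ℕ))
    (fun i j hij => Fin.ext (hζ.pow_inj i.2 j.2 hij))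
    (fun i hi => by
      rw [← h i hi]
      refine Finset.sum_congr rfl fun l _ => ?_
      rw [mul_pow, ← pow_mul, ← pow_mul, mul_comm (l : ℕ) i]
      ring)
    (by
      refine le_trans (Finset.card_le_card fun l hl => ?_) hle
      rw [Finset.mem_filter] at hl ⊢
      exact ⟨hl.1, fun h0 => hl.2 (by simp [h0])⟩)
  apply hc
  funext l
  have := congrFun hy l
  simpa [hx] using this

/-- A code of dimension greater than `n - |S|` contains a nonzero word supported on `S`. -/
theorem exists_mem_ne_zero_support_subset {S : Finset (Fin n)}
    (hS : n < Module.finrank F C + S.card) : ∃ c ∈ C, c ≠ 0 ∧ ∀ i, i ∉ S → c i = 0 := by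
  classical
  let f : C →ₗ[F] ({i // i ∉ S} → F) :=
    (LinearMap.funLeft F F (Subtype.val : {i // i ∉ S} → Fin n)) ∘ₗ C.subtype
  have hlt : Module.finrank F ({i // i ∉ S} → F) < Module.finrank F C := by
    rw [Module.finrank_fintype_fun_eq_card, Fintype.card_subtype_compl, Fintype.card_fin,
      Fintype.card_coe]
    have := S.card_le_univ
    rw [Fintype.card_fin] at this
    omega
  obtain ⟨c, hc, hc0⟩ := Submodule.exists_mem_ne_zero_of_ne_bot 
    (LinearMap.ker_ne_bot_of_finrank_lt (f := f) hlt)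
  refine ⟨c, c.2, fun h => hc0 (Subtype.ext h), fun i hi => ?_⟩
  exact congrFun (LinearMap.mem_ker.1 hc) ⟨i, hi⟩

/-- An MDS code of dimension greater than `n / 2` contains two words of minimum weight that are not
orthogonal for the Hermitian form. -/
theorem exists_hammingNorm_eq_and_sum_ne_zero [DecidableEq F] (hdim : Module.finrank F C + m = n)
    (hwt : ∀ c ∈ C, c ≠ 0 → m < hammingNorm c) (hmn : 2 * m < n) {q : ℕ} (hq : q ≠ 0) :
    ∃ c ∈ C, hammingNorm c = m + 1 ∧ ∃ c' ∈ C, ∑ i, c' i * c i ^ q ≠ 0 := by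
  have hword : ∀ S : Finset (Fin n), S.card = m + 1 →
      ∃ c ∈ C, hammingNorm c = m + 1 ∧ (∀ i, i ∉ S → c i = 0) ∧ ∀ i ∈ S, c i ≠ 0 := by
    intro S hS
    obtain ⟨c, hc, hc0, hcS⟩ := exists_mem_ne_zero_support_subset (C := C) (S := S) (by omega)
    have hsub : (Finset.univ.filter fun i => c i ≠ 0) ⊆ S := by
      intro i hi
      by_contra hiS
      exact (Finset.mem_filter.1 hi).2 (hcS i hiS)
    have heq : (Finset.univ.filter fun i => c i ≠ 0) = S :=
      Finset.eq_of_subset_of_card_le hsub (by rw [hS]; exact hwt c hc hc0)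
    refine ⟨c, hc, ?_, hcS, fun i hi => ?_⟩
    · rw [← hS, ← heq]
      rfl
    · rw [← heq] at hi
      exact (Finset.mem_filter.1 hi).2
  -- The supports `{0, …, m}` and `{m, …, 2m}` share only position `m`, so the Hermitian product has
  -- a single nonzero term.
  let a : Fin n := ⟨m, by omega⟩
  obtain ⟨c, hc, hcm, hc1, hc2⟩ := hword (Finset.Iic a) (by rw [Fin.card_Iic])
  obtain ⟨c', hc', -, hc1', hc2'⟩ := hword (Finset.Icc a ⟨2 * m, hmn⟩) (by
    rw [Fin.card_Icc]
    simp only [a]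
    omega)
  refine ⟨c, hc, hcm, c', hc', ?_⟩
  have hca : c a ≠ 0 := hc2 a (Finset.mem_Iic.2 le_rfl)
  have hca' : c' a ≠ 0 := hc2' a (Finset.mem_Icc.2 ⟨le_rfl, by
    rw [Fin.le_def]
    simp only [a]
    omega⟩)
  rw [Finset.sum_eq_single a]
  · exact mul_ne_zero hca' (pow_ne_zero q hca)
  · intro i _ hi
    by_cases h : a ≤ i
    · rw [hc1 i fun h' => hi (le_antisymm (Finset.mem_Iic.1 h') h), zero_pow hq, mul_zero]
    · rw [hc1' i fun h' => h (Finset.mem_Icc.1 h').1, zero_mul]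
  · simp

end Code

/-! ### Ranks -/

section Rank

variable {F K : Type*} [Field F] [Field K]

/-- The rank of a multiple of a partial permutation matrix. -/
theorem rank_eq_ncard_of_partial_permutation {ι : Type*} [Fintype ι] {M : Matrix ι ι K}
    {ρ : ι → ι → Prop} [∀ i j, Decidable (ρ i j)] {a : K} (ha : a ≠ 0)
    (hM : ∀ i j, M i j = if ρ i j then a else 0)
    (hρ : ∀ i i' j, ρ i j → ρ i' j → i = i') :
    M.rank = {i | ∃ j, ρ i j}.ncard := by
  classical
  have hcol : ∀ i j, ρ i j → M.col j = a • Pi.single i (1 : K) := by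
    intro i j hij
    funext i'
    rw [Matrix.col_apply, hM, Pi.smul_apply, smul_eq_mul, Pi.single_apply, mul_ite, mul_one,
      mul_zero]
    refine if_congr ⟨fun h => hρ _ _ _ h hij, ?_⟩ rfl rfl
    rintro rfl
    exact hij
  let f : {i | ∃ j, ρ i j} → (ι → K) := fun i => Pi.single (i : ι) 1
  have hspan : Submodule.span K (Set.range M.col) = Submodule.span K (Set.range f) := by
    apply le_antisymm
    · rw [Submodule.span_le]
      rintro _ ⟨j, rfl⟩
      by_cases hj : ∃ i, ρ i j
      · obtain ⟨i, hij⟩ := hj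
        rw [SetLike.mem_coe, hcol i j hij]
        exact Submodule.smul_mem _ _ (Submodule.subset_span ⟨⟨i, j, hij⟩, rfl⟩)
      · have : M.col j = 0 := by
          funext i
          rw [Matrix.col_apply, hM, if_neg fun h => hj ⟨i, h⟩]
          rfl
        rw [this]
        exact Submodule.zero_mem _
    · rw [Submodule.span_le]
      rintro _ ⟨⟨i, j, hij⟩, rfl⟩
      have : f ⟨i, j, hij⟩ = a⁻¹ • M.col j := by
        rw [hcol i j hij, smul_smul, inv_mul_cancel₀ ha, one_smul]
      rw [this]
      exact Submodule.smul_mem _ _ (Submodule.subset_span ⟨j, rfl⟩)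
  have hli : LinearIndependent K f := by
    have := (Pi.basisFun K ι).linearIndependent.comp
      (Subtype.val : {i | ∃ j, ρ i j} → ι) Subtype.val_injective
    convert this using 1
    funext i
    simp [f]
  rw [Matrix.rank_eq_finrank_span_cols, hspan, finrank_span_eq_card hli, ← Nat.card_eq_fintype_card]
  rfl

/-- The rank of a square matrix does not change under a field extension. -/
theorem rank_map_of_field {ι : Type*} [Fintype ι] (f : F →+* K) (M : Matrix ι ι F) :
    (M.map f).rank = M.rank := by
  classical
  -- The normal form has entries `0` and `1`, so it survives the field extension.
  obtain ⟨V, U, e, hV, hU, h⟩ := M.exists_rank_normal_form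
  have hdiag : ((Matrix.fromBlocks 1 0 0 0 :
      Matrix (Fin M.rank ⊕ Fin (Fintype.card ι - M.rank)) _ K).submatrix e e).rank = M.rank := by
    rw [Matrix.rank_submatrix, ← Matrix.diagonal_one, ← Matrix.diagonal_zero,
      Matrix.fromBlocks_diagonal, Matrix.rank_diagonal]
    conv_rhs => rw [← Fintype.card_fin M.rank]
    refine (Fintype.card_of_bijective (f := fun i : Fin M.rank => ⟨Sum.inl i, by simp⟩) ⟨?_, ?_⟩).symm
    · intro i j hij
      exact Sum.inl_injective (congrArg Subtype.val hij)
    · rintro ⟨i | i, hi⟩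
      · exact ⟨i, rfl⟩
      · simp at hi
  have hK : V.map f * M.map f * U.map f = (Matrix.fromBlocks 1 0 0 0 :
      Matrix (Fin M.rank ⊕ Fin (Fintype.card ι - M.rank)) _ K).submatrix e e := by
    rw [← Matrix.map_mul, ← Matrix.map_mul, h, ← Matrix.submatrix_map, Matrix.fromBlocks_map]
    simp
  have hV' : IsUnit (V.map f).det := (Matrix.isUnit_iff_isUnit_det _).1 (hV.map f.mapMatrix)
  have hU' : IsUnit (U.map f).det := (Matrix.isUnit_iff_isUnit_det _).1 (hU.map f.mapMatrix)
  rw [← hdiag, ← hK, Matrix.rank_mul_eq_left_of_isUnit_det _ _ hU',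
    Matrix.rank_mul_eq_right_of_isUnit_det _ _ hV']

variable [Algebra F K] {q n m r e₀ : ℕ} {δ : K} {C : Submodule F (Fin n → F)}

/-- The number of pairs that a constacyclic code with consecutive roots requires. -/
theorem rank_mul_hermTranspose {φ : K →+* K} (hφ : ∀ x, φ x = x ^ q) (hr : r = q + 1)
    (hn : (n : K) ≠ 0) (hδ : IsPrimitiveRoot δ (r * n)) (hm : m ≤ n)
    (hroots : ∀ c ∈ C, ∀ i < m, ∑ l, algebraMap F K (c l) * (δ ^ (e₀ + r * i)) ^ (l : ℕ) = 0)
    {H : Matrix (Fin m) (Fin n) F} (hH : IsParityCheck C H) :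
    (H * hermTranspose q H).rank =
      (consecutiveSet r n e₀ m ∩ negMulSet q (consecutiveSet r n e₀ m)).ncard := by
  classical
  have hn0 : n ≠ 0 := by
    rintro rfl
    simp at hn
  have hδ0 : δ ≠ 0 := hδ.ne_zero (Nat.mul_ne_zero (by omega) hn0)
  have hζ : IsPrimitiveRoot (δ ^ r) n :=
    hδ.pow (Nat.pos_of_ne_zero (Nat.mul_ne_zero (by omega) hn0)) rfl
  have hinj : ∀ i j : Fin m, δ ^ (e₀ + r * i) = δ ^ (e₀ + r * j) → i = j := by
    intro i j hij
    simp only [pow_add, pow_mul] at hij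
    exact Fin.ext (hζ.pow_inj (i.2.trans_le hm) (j.2.trans_le hm)
      (mul_left_cancel₀ (pow_ne_zero _ hδ0) hij))
  let W : Matrix (Fin m) (Fin n) K := Matrix.of fun i l => (δ ^ (e₀ + r * i)) ^ (l : ℕ)
  let ι : F →+* K := algebraMap F K
  obtain ⟨R, hR⟩ := hH.exists_mul_eq_one
  -- The columns of `1 - R H` are codewords, which `W` annihilates; hence `W` factors through `H`.
  have hW0 : W * (1 - R * H).map ι = 0 := by
    ext i j
    have hcol : (fun l => (1 - R * H : Matrix (Fin n) (Fin n) F) l j) ∈ C := by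
      rw [hH.2]
      have h0 : H * (1 - R * H) = 0 := by
        rw [Matrix.mul_sub, Matrix.mul_one, ← Matrix.mul_assoc, hR, Matrix.one_mul, sub_self]
      funext i'
      exact congrFun (congrFun h0 i') j
    have := hroots _ hcol i i.2
    rw [Matrix.mul_apply, Matrix.zero_apply, ← this]
    exact Finset.sum_congr rfl fun l _ => mul_comm _ _
  let P : Matrix (Fin m) (Fin m) K := W * R.map ι
  have hWP : W = P * H.map ι := by
    rw [Matrix.map_sub _ (map_sub ι), Matrix.map_one _ (map_zero ι) (map_one ι), Matrix.mul_sub,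
      Matrix.mul_one, sub_eq_zero, Matrix.map_mul, ← Matrix.mul_assoc] at hW0
    exact hW0
  -- A left null vector of `P` is one of the Vandermonde matrix `W`, whose `m ≤ n` nodes are
  -- distinct.
  have hPunit : IsUnit P := by
    rw [← Matrix.vecMul_injective_iff_isUnit]
    refine (injective_iff_map_eq_zero (Matrix.vecMulLinear P)).2 fun y hy => ?_
    have hyP : y ᵥ* P = 0 := hy
    have hyW : y ᵥ* W = 0 := by rw [hWP, ← Matrix.vecMul_vecMul, hyP, Matrix.zero_vecMul]
    refine eq_zero_of_sum_pow_eq_zero (m := n) (v := fun i : Fin m => δ ^ (e₀ + r * i))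
      (fun i j hij => hinj i j hij) (fun l hl => congrFun hyW ⟨l, hl⟩) ?_
    exact hammingNorm_le_card_fintype.trans (by rwa [Fintype.card_fin])
  have hPunit' : IsUnit (P.map φ)ᵀ := by
    rw [Matrix.isUnit_transpose]
    exact hPunit.map φ.mapMatrix
  have hprod : W * (W.map φ)ᵀ = P * (H * hermTranspose q H).map ι * (P.map φ)ᵀ := by
    have hherm : (hermTranspose q H).map ι = ((H.map ι).map φ)ᵀ := by
      ext i j
      simp [hermTranspose, hφ]
    have hWφ : (W.map φ)ᵀ = ((H.map ι).map φ)ᵀ * (P.map φ)ᵀ := by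
      conv_lhs => rw [hWP, Matrix.map_mul, Matrix.transpose_mul]
    have hHH : (H * hermTranspose q H).map ι = H.map ι * ((H.map ι).map φ)ᵀ := by
      rw [Matrix.map_mul, hherm]
    rw [hWφ, hHH]
    conv_lhs => rw [hWP]
    simp only [Matrix.mul_assoc]
  have hrank : (H * hermTranspose q H).rank = (W * (W.map φ)ᵀ).rank := by
    rw [hprod,
      Matrix.rank_mul_eq_left_of_isUnit_det _ _ ((Matrix.isUnit_iff_isUnit_det _).1 hPunit'),
      Matrix.rank_mul_eq_right_of_isUnit_det _ _ ((Matrix.isUnit_iff_isUnit_det _).1 hPunit),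
      rank_map_of_field]
  let ρ : Fin m → Fin m → Prop := fun i j =>
    δ ^ (e₀ + r * i) * (δ ^ (e₀ + r * j)) ^ q = 1
  have hentry : ∀ i j, (W * (W.map φ)ᵀ) i j = if ρ i j then (n : K) else 0 := by
    intro i j
    set ξ := δ ^ (e₀ + r * i) * (δ ^ (e₀ + r * j)) ^ q with hξ
    have h1 : (W * (W.map φ)ᵀ) i j = ∑ l ∈ Finset.range n, ξ ^ l := by
      rw [Matrix.mul_apply, ← Fin.sum_univ_eq_sum_range fun l => ξ ^ l]
      refine Finset.sum_congr rfl fun l _ => ?_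
      simp only [W, Matrix.transpose_apply, Matrix.map_apply, Matrix.of_apply, hφ, hξ]
      rw [mul_pow, pow_right_comm (δ ^ (e₀ + r * (j : ℕ)))]
    have hξn : ξ ^ n = 1 := by
      rw [hξ, ← pow_mul, ← pow_add, ← pow_mul, hδ.pow_eq_one_iff_dvd]
      refine mul_dvd_mul_right ⟨e₀ + i + q * j, ?_⟩ n
      rw [hr]
      ring
    rw [h1]
    split_ifs with h
    · rw [show ξ = 1 from h]
      simp
    · have h2 := geom_sum_mul ξ n
      rw [hξn, sub_self, mul_eq_zero] at h2
      exact h2.resolve_right (sub_ne_zero.2 h)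
  rw [hrank, rank_eq_ncard_of_partial_permutation hn hentry]
  · let f : Fin m → ZMod (r * n) := fun i => ((e₀ + r * i : ℕ) : ZMod (r * n))
    have hρ : ∀ i j, ρ i j ↔ f i = -(q * f j) := by
      intro i j
      change δ ^ (e₀ + r * i) * (δ ^ (e₀ + r * j)) ^ q = 1 ↔ _
      rw [← pow_mul, ← pow_add, hδ.pow_eq_one_iff_dvd, ← ZMod.natCast_eq_zero_iff,
        eq_neg_iff_add_eq_zero]
      simp only [f]
      push_cast
      rw [mul_comm (q : ZMod (r * n))]
    have hf : Function.Injective f := by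
      intro i j hij
      apply hinj
      rw [← hδ.pow_val_natCast, ← hδ.pow_val_natCast (e₀ + r * j)]
      exact congrArg (fun z : ZMod (r * n) => δ ^ z.val) hij
    rw [← Set.ncard_image_of_injective _ hf]
    congr 1
    ext z
    constructor
    · rintro ⟨i, ⟨j, hij⟩, rfl⟩
      exact ⟨⟨i, i.2, rfl⟩, ⟨f j, ⟨j, j.2, rfl⟩, ((hρ i j).1 hij).symm⟩⟩
    · rintro ⟨⟨i, hi, rfl⟩, ⟨_, ⟨j, hj, rfl⟩, h⟩⟩
      exact ⟨⟨i, hi⟩, ⟨⟨j, hj⟩, (hρ _ _).2 h.symm⟩, rfl⟩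
  · intro i i' j h h'
    apply hinj
    exact mul_right_cancel₀ (pow_ne_zero _ (pow_ne_zero _ hδ0)) (Eq.trans h h'.symm)

end Rank

/-! ### Assembly of the main theorem -/

theorem exponent_image_eq_consecutiveSet {r n s T : ℕ} (h : r * T ≤ s) :
    exponent r n s '' {t | |t| ≤ T} = consecutiveSet r n (s - r * T) (2 * T + 1) := by
  have hcast : ∀ i : ℕ, ((s - r * T + r * i : ℕ) : ZMod (r * n)) = exponent r n s (i - T) := by
    intro i
    rw [exponent]
    push_cast [h]
    ring
  ext z
  constructor
  · rintro ⟨t, ht, rfl⟩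
    rw [Set.mem_ofPred_eq, abs_le] at ht
    refine ⟨(t + T).toNat, by omega, ?_⟩
    rw [hcast, Int.toNat_of_nonneg (by omega), add_sub_cancel_right]
  · rintro ⟨i, hi, rfl⟩
    refine ⟨i - T, ?_, (hcast i).symm⟩
    rw [Set.mem_ofPred_eq, abs_le]
    omega

theorem mainTheorem1
    (q n r s lam : ℕ) (hq : IsPrimePow q) (hq7 : q % 10 = 7) (hq_gt : 7 < q)
    (hn : 10 * n = q ^ 2 + 1) (hr : r = q + 1) (hs : 2 * s = q ^ 2 + 1)
    (hlam : 1 ≤ lam) (hlam' : (lam : ℚ) ≤ ((q : ℚ) + 3) / 10)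
    {F K : Type*} [Field F] [Fintype F] [DecidableEq F] (hF : Fintype.card F = q ^ 2)
    [Field K] [Algebra F K]
    (α : F) (hα : IsPrimitiveRoot α r)
    (δ : K) (hδ : IsPrimitiveRoot δ (r * n)) (hδα : δ ^ n = algebraMap F K α)
    (Z : Set (ZMod (r * n)))
    (hZ : Z = ⋃ j ∈ Set.Iic (3 * (q - 7) / 10 + 1 + lam),
      cyclotomicCoset q (r * n) ((s : ZMod (r * n)) - (r : ZMod (r * n)) * (j : ZMod (r * n))))
    (C : Submodule F (Fin n → F)) (hC : IsConstacyclic α C) (hCZ : HasDefiningSet r α δ C Z) :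
    -- the intersection of `Z` and `-q Z` consists of exactly three cosets with five elements
    (Z ∩ negMulSet q Z =
        cyclotomicCoset q (r * n) (s : ZMod (r * n)) ∪
        cyclotomicCoset q (r * n)
          ((s : ZMod (r * n)) - (r : ZMod (r * n)) * (((3 * q - 1) / 10 : ℕ) : ZMod (r * n))) ∪
        cyclotomicCoset q (r * n)
          ((s : ZMod (r * n)) - (r : ZMod (r * n)) * (((q + 3) / 10 : ℕ) : ZMod (r * n))) ∧
      (Z ∩ negMulSet q Z).ncard = 5) ∧
    ∃ k d : ℕ,
      (k : ℚ) = (n : ℚ) - 6 / 5 * ((q : ℚ) - 7) - 4 * lam - 1 ∧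
      (d : ℚ) = 3 / 5 * ((q : ℚ) - 7) + 2 * lam + 4 ∧
      -- `C` has dimension `n - d + 1`, minimum distance `d`, and requires `5` entangled pairs
      Module.finrank F C + d = n + 1 ∧
      IsMinWeight C d ∧
      (∀ (m : ℕ) (H : Matrix (Fin m) (Fin n) F), IsParityCheck C H →
        (H * hermTranspose q H).rank = 5) ∧
      -- existence of the entanglement-assisted quantum MDS code
      ExistsEAQMDS q n k d 5 := by
  obtain ⟨u, hu⟩ : ∃ u, q = 10 * u + 7 := ⟨q / 10, by omega⟩
  have hu1 : 1 ≤ u := by omega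
  have hnu : n = 10 * u ^ 2 + 14 * u + 5 := by
    rw [hu] at hn
    nlinarith
  have hs5 : s = 5 * n := by omega
  -- Gives `T ≤ 4u + 2`, just below the threshold `a + b = 4u + 3` of the lattice argument; `1 ≤
  -- lam` gives `T ≥ b`.
  have hlamu : lam ≤ u + 1 := by
    have h : (10 * lam : ℚ) ≤ q + 3 := by linarith
    have : 10 * lam ≤ q + 3 := by exact_mod_cast h
    omega
  obtain ⟨T, hT⟩ : ∃ T, T = 3 * u + 1 + lam := ⟨_, rfl⟩
  have hTq : 3 * (q - 7) / 10 + 1 + lam = T := by omega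
  have hrT : r * T ≤ s := by
    have : T ≤ 4 * u + 2 := by omega
    calc r * T ≤ r * (4 * u + 2) := Nat.mul_le_mul_left r this
      _ ≤ s := by
        rw [hs5, hnu, hr, hu]
        nlinarith
  -- Here `u ≥ 1`, that is `q > 7`, is needed. The bound leaves room for the two overlapping
  -- supports, yields `d ≤ (n + 2) / 2`, and keeps `n + 5 - 2m` free of truncation.
  have hmn : 2 * (2 * T + 1) < n := by
    have : 16 * u + 10 < n := by
      rw [hnu]
      nlinarith
    omega
  have hr0 : r ≠ 0 := by omega
  have hn0 : 0 < n := by omega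
  rw [hTq, iUnion_cyclotomicCoset hn hr hs5] at hZ
  have hinter : Z ∩ negMulSet q Z = exponent r n s ''
      {0, 3 * (u : ℤ) + 2, -(3 * (u : ℤ) + 2), (u : ℤ) + 1, -((u : ℤ) + 1)} := by
    rw [hZ]
    exact inter_negMulSet_exponent hu hnu hr hs5 (by omega) (by omega)
  have hcard : (Z ∩ negMulSet q Z).ncard = 5 := by
    rw [hinter]
    exact ncard_exponent_image hnu hr0
  refine ⟨⟨?_, hcard⟩, ?_⟩
  · have h0 : (s : ZMod (r * n)) = exponent r n s 0 := by simp [exponent]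
    have hcoset : ∀ j : ℕ, (s : ZMod (r * n)) - (r : ZMod (r * n)) * (j : ZMod (r * n)) =
        exponent r n s (-j) := by
      intro j
      rw [exponent]
      push_cast
      ring
    have hb : (3 * q - 1) / 10 = 3 * u + 2 := by omega
    have ha : (q + 3) / 10 = u + 1 := by omega
    rw [hcoset, hcoset, h0, cyclotomicCoset_exponent hn hr hs5, cyclotomicCoset_exponent hn hr hs5,
      cyclotomicCoset_exponent hn hr hs5, hinter, hb, ha]
    ext z
    simp only [Set.image_insert_eq, Set.image_singleton, Set.mem_insert_iff, Set.mem_singleton_iff,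
      Set.mem_union, neg_neg, neg_zero, or_self]
    push_cast
    tauto
  rw [exponent_image_eq_consecutiveSet hrT] at hZ
  set m := 2 * T + 1 with hm
  obtain ⟨g, hg, hgdeg, hgroot⟩ := exists_generator_of_hasDefiningSet hr0 hn0.ne' hδ hδα
    (by omega) (hZ ▸ hCZ)
  have hdim : Module.finrank F C + m = n := by
    rw [← hgdeg]
    exact finrank_add_natDegree_of_isGeneratorPoly hn0 hg (by omega)
  have hroots : ∀ c ∈ C, ∀ i < m,
      ∑ l, algebraMap F K (c l) * (δ ^ (s - r * T + r * i)) ^ (l : ℕ) = 0 := by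
    intro c hc i hi
    rw [← aeval_wordPoly]
    exact Polynomial.aeval_eq_zero_of_dvd_aeval_eq_zero ((hg.2.2 c).1 hc) (hgroot i hi)
  have hrn : 0 < r * n := Nat.mul_pos (Nat.pos_of_ne_zero hr0) hn0
  have hδ0 : δ ≠ 0 := hδ.ne_zero hrn.ne'
  have hwt : ∀ c ∈ C, c ≠ 0 → m < hammingNorm c := by
    intro c hc
    refine lt_hammingNorm_of_roots (pow_ne_zero (s - r * T) hδ0) (hδ.pow hrn rfl) fun i hi => ?_
    rw [← pow_mul, ← pow_add]
    exact hroots c hc i hi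
  have hqF : (q : F) = 0 := by
    have h := FiniteField.cast_card_eq_zero F
    rw [hF] at h
    push_cast at h
    exact eq_zero_of_pow_eq_zero h
  have hqK : (q : K) = 0 := by
    rw [← map_natCast (algebraMap F K), hqF, map_zero]
  -- In `K`, `q = 0`, so `10 n = 1`.
  have hnK : (n : K) ≠ 0 := by
    intro h
    have h1 : (10 : K) * n = q ^ 2 + 1 := by exact_mod_cast congrArg Nat.cast hn
    rw [h, hqK] at h1
    simp at h1
  have h2F : (2 : F) ≠ 0 := by
    intro h
    have h1 : (q : F) = 10 * u + 7 := by exact_mod_cast congrArg Nat.cast hu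
    apply one_ne_zero (α := F)
    linear_combination hqF - h1 - (5 * u + 3) * h
  obtain ⟨φ, hφ⟩ := exists_ringHom_eq_pow hF K
  have hrank : ∀ (m' : ℕ) (H : Matrix (Fin m') (Fin n) F), IsParityCheck C H →
      (H * hermTranspose q H).rank = 5 := by
    intro m' H hH
    obtain rfl : m' = m := by
      have := hH.1
      omega
    rw [rank_mul_hermTranspose hφ hr hnK hδ (by omega) hroots hH, ← hZ, hcard]
  obtain ⟨c, hc, hcm, hc'⟩ :=
    exists_hammingNorm_eq_and_sum_ne_zero hdim hwt hmn (q := q) (by omega)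
  have hqQ : (q : ℚ) = 10 * u + 7 := by exact_mod_cast hu
  have hTQ : (T : ℚ) = 3 * u + 1 + lam := by exact_mod_cast hT
  have hkQ : ((n + 5 - 2 * m : ℕ) : ℚ) = n + 5 - 2 * m := by
    rw [Nat.cast_sub (by omega)]
    push_cast
    ring
  have hmQ : (m : ℚ) = 2 * T + 1 := by exact_mod_cast hm
  refine ⟨n + 5 - 2 * m, m + 1, ?_, ?_, by omega, ⟨⟨c, hc, ?_, hcm⟩, ?_⟩, hrank, ?_, ?_, ?_⟩
  · rw [hkQ, hmQ, hTQ, hqQ]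
    ring
  · push_cast
    rw [hmQ, hTQ, hqQ]
    ring
  · rintro rfl
    simp at hcm
  · rintro w ⟨c, hc, hc0, rfl⟩
    exact hwt c hc hc0
  · obtain ⟨H, hH⟩ := exists_isParityCheck hdim
    have h5 := hrank m H hH
    have := exists_eaqecc_of_isParityCheck (k := n + 5 - 2 * m) (d := m + 1) hF (by omega) h2F hH
      (by rw [h5]; omega) hwt ⟨c, hc, hcm, hc'⟩
    rwa [h5] at this
  · have : (2 * m + 1 : ℚ) ≤ n := by exact_mod_cast hmn
    push_cast
    linarith
  · rw [hkQ]
    push_cast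
    ring
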